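/- **Setting.** A *term language* is given by finitely many function symbols $h$ of fixed arities, each with a fixed $C^\infty$ interpretation $h:\mathbb R^k\to\mathbb R$ and, for every $i$, a fixed extended term in the variables $y_1,\dots,y_k$ that represents the partial derivative $\partial h/\partial y_i$. *Extended terms* are built from variables (there are infinitely many), rational constants, $+$, $\cdot$ and the symbols $h$; general terms may also contain differential variables $x'$ and differentials $(e)'$. *Semianalytic formulas* are built from comparisons ($=,\ge,>$) of extended terms by $\land,\lor,\lnot$; they are *analytic* if only equations, $\land$ and $\lor$ are used. *Hybrid programs* are $$\alpha,\beta ::= x:=e \mid {?Q} \mid x'=f(x)\,\&\,Q \mid \alpha\cup\beta \mid \alpha;\beta \mid \alpha^*$$ with extended terms $e,f$ (and $x'=f(x)$ a vectorial differential equation for pairwise distinct variables) and semianalytic $Q$; $\alpha$ is *analytic* if every test $Q$ and every evolution domain constraint $Q$ in it is the negation of an analytic formula. Derivability refers to the sequent calculus of differential dynamic logic (dL): classical first-order sequent rules (with congruence of equality for the function symbols), all substitution instances of valid formulas of first-order real arithmetic, the hybrid program axioms $[:=],[?],[\cup],[;],[{}^*]$, I, the modal axioms and rules $\langle\cdot\rangle$,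 K, V, G, the differential axioms (including the axiom for $(h(e_1,\dots,e_k))'$ given by the chosen partial derivatives), the differential equation axioms DE, DW, DX, DMP, DC, DG, B$'$, DI (for $e=0$, $e\ge0$, $e>0$, where variables of $e$ that do not evolve are required to have differential $0$) and the axioms of uniqueness, continuous existence, differential adjoints and real induction. The term language is *Noetherian* if for every finite set $V$ of variables the ring of the real-valued functions of the state denoted by the extended terms with variables in $V$ is Noetherian. It has *decidable (and provable) ideal membership* if there is an algorithm that, for all extended terms $e,e_1,\dots,e_k$, either returns extended terms $g_1,\dots,g_k$ for which $e=\sum_{i=1}^k g_ie_i$ is derivable in dL, or correctly reports that $e$ is not in the ideal generated by $e_1,\dots,e_k$ in the ring of functions denoted by extended terms. **Corollary (Analytic hybrid program completeness).** Let the term language be Noetherian with decidable (and provable) ideal membership. Then there is an algorithm that, given any analytic hybrid program $\alpha$ and any analytic formula $P$, computes an extended term $e$ such that the equivalence $$[\alpha]P \leftrightarrow e=0$$ is derivable in dL. -/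

import Mathlib

namespace DL

/-! ### Syntax of differential dynamic logic over an extended term language -/

/-- Finitely many fixed function symbols with their arities. -/
structure Signature where
  num : ℕ
  arity : Fin num → ℕ

/-- A variable: `⟨n, 0⟩` is the ordinary variable with name `n`, and `⟨n, k + 1⟩` is the
differential variable of `⟨n, k⟩`. -/
structure Var where
  name : ℕ
  ord : ℕ
deriving DecidableEq

/-- The ordinary (non-differential) variable with a given name. -/
def Var.base (n : ℕ) : Var := ⟨n, 0⟩

/-- The differential variable associated with a variable. -/
def Var.prime (x : Var) : Var := ⟨x.name, x.ord + 1⟩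

/-- Extended terms, i.e. terms without differentials and differential variables. -/
inductive ETerm (S : Signature) : Type
  | var (n : ℕ) : ETerm S
  | const (c : ℚ) : ETerm S
  | add (a b : ETerm S) : ETerm S
  | mul (a b : ETerm S) : ETerm S
  | app (h : Fin S.num) (args : Fin (S.arity h) → ETerm S) : ETerm S

/-- All terms, including differential variables and differentials. -/
inductive Term (S : Signature) : Type
  | var (x : Var) : Term S
  | const (c : ℚ) : Term S
  | add (a b : Term S) : Term S
  | mul (a b : Term S) : Term S
  | app (h : Fin S.num) (args : Fin (S.arity h) → Term S) : Term S
  | diff (e : Term S) : Term S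

/-- Comparison operators `=`, `≥`, `>`. -/
inductive Cmp : Type
  | eq | ge | gt

/-- Semianalytic formulas: no quantifiers, no modalities, no differentials. -/
inductive SFml (S : Signature) : Type
  | cmp (c : Cmp) (a b : ETerm S) : SFml S
  | and (P Q : SFml S) : SFml S
  | or (P Q : SFml S) : SFml S
  | not (P : SFml S) : SFml S

/-- A vectorial differential equation: the entries `(n, f)` stand for the equations with
left-hand side the derivative of variable `n` and right-hand side `f`; the variables are
pairwise distinct. -/
structure ODE (S : Signature) where
  sys : List (ℕ × ETerm S)
  nodup : (sys.map Prod.fst).Nodup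

/-- Hybrid programs. -/
inductive Program (S : Signature) : Type
  | assign (x : Var) (e : ETerm S) : Program S
  | test (Q : SFml S) : Program S
  | ode (o : ODE S) (Q : SFml S) : Program S
  | choice (α β : Program S) : Program S
  | seq (α β : Program S) : Program S
  | star (α : Program S) : Program S

/-- Formulas of differential dynamic logic. -/
inductive Formula (S : Signature) : Type
  | cmp (c : Cmp) (a b : Term S) : Formula S
  | and (φ ψ : Formula S) : Formula S
  | or (φ ψ : Formula S) : Formula S
  | not (φ : Formula S) : Formula S
  | all (x : Var) (φ : Formula S) : Formula S
  | ex (x : Var) (φ : Formula S) : Formula S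
  | box (α : Program S) (φ : Formula S) : Formula S
  | dia (α : Program S) (φ : Formula S) : Formula S

variable {S : Signature}

/-- `P` is formed from equations by conjunctions and disjunctions only. -/
def SFml.IsAnalytic : SFml S → Prop
  | .cmp .eq _ _ => True
  | .cmp .ge _ _ => False
  | .cmp .gt _ _ => False
  | .and P Q => P.IsAnalytic ∧ Q.IsAnalytic
  | .or P Q => P.IsAnalytic ∧ Q.IsAnalytic
  | .not _ => False

/-- All tests and domain constraints are negations of analytic formulas. -/
def Program.IsAnalytic : Program S → Prop
  | .assign _ _ => True
  | .test Q => ∃ A : SFml S, A.IsAnalytic ∧ Q = .not A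
  | .ode _ Q => ∃ A : SFml S, A.IsAnalytic ∧ Q = .not A
  | .choice α β => α.IsAnalytic ∧ β.IsAnalytic
  | .seq α β => α.IsAnalytic ∧ β.IsAnalytic
  | .star α => α.IsAnalytic

/-! ### Embeddings and simultaneous replacement in extended terms -/

/-- Replace every variable `n` by the term `σ n`. -/
def ETerm.inst (σ : ℕ → Term S) : ETerm S → Term S
  | .var n => σ n
  | .const c => .const c
  | .add a b => .add (a.inst σ) (b.inst σ)
  | .mul a b => .mul (a.inst σ) (b.inst σ)
  | .app h args => .app h (fun i => (args i).inst σ)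

/-- Replace every variable `n` by the extended term `σ n`. -/
def ETerm.bind (σ : ℕ → ETerm S) : ETerm S → ETerm S
  | .var n => σ n
  | .const c => .const c
  | .add a b => .add (a.bind σ) (b.bind σ)
  | .mul a b => .mul (a.bind σ) (b.bind σ)
  | .app h args => .app h (fun i => (args i).bind σ)

def SFml.bind (σ : ℕ → ETerm S) : SFml S → SFml S
  | .cmp c a b => .cmp c (a.bind σ) (b.bind σ)
  | .and P Q => .and (P.bind σ) (Q.bind σ)
  | .or P Q => .or (P.bind σ) (Q.bind σ)
  | .not P => .not (P.bind σ)

/-- An extended term as a term. -/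
def ETerm.toTerm (e : ETerm S) : Term S := e.inst (fun n => .var (Var.base n))

/-- A semianalytic formula as a formula. -/
def SFml.toFormula : SFml S → Formula S
  | .cmp c a b => .cmp c a.toTerm b.toTerm
  | .and P Q => .and P.toFormula Q.toFormula
  | .or P Q => .or P.toFormula Q.toFormula
  | .not P => .not P.toFormula

/-- Implication, as an abbreviation. -/
def Formula.imp (φ ψ : Formula S) : Formula S := .or (.not φ) ψ

/-- Equivalence, as an abbreviation. -/
def Formula.iff (φ ψ : Formula S) : Formula S := .and (.imp φ ψ) (.imp ψ φ)

/-- The formula `a = b`. -/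
def Formula.eq (a b : Term S) : Formula S := .cmp .eq a b

/-- The formula `false`, as the abbreviation `1 = 0`. -/
def Formula.fls : Formula S := .eq (.const 1) (.const 0)

/-- The formula `true`, as the abbreviation `0 = 0`. -/
def SFml.tru : SFml S := .cmp .eq (.const 0) (.const 0)

/-! ### Free and bound variables -/

/-- The names of the variables of an extended term. -/
def ETerm.vars : ETerm S → Finset ℕ
  | .var n => {n}
  | .const _ => ∅
  | .add a b => a.vars ∪ b.vars
  | .mul a b => a.vars ∪ b.vars
  | .app _ args => Finset.univ.biUnion fun i => (args i).vars

def SFml.vars : SFml S → Finset ℕ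
  | .cmp _ a b => a.vars ∪ b.vars
  | .and P Q => P.vars ∪ Q.vars
  | .or P Q => P.vars ∪ Q.vars
  | .not P => P.vars

/-- The value of the differential of `e` depends on the variables of `e` and on their
differential variables. -/
def Term.fv : Term S → Finset Var
  | .var x => {x}
  | .const _ => ∅
  | .add a b => a.fv ∪ b.fv
  | .mul a b => a.fv ∪ b.fv
  | .app _ args => Finset.univ.biUnion fun i => (args i).fv
  | .diff e => e.fv ∪ e.fv.image Var.prime

/-- The names of the variables that evolve. -/
def ODE.lhs (o : ODE S) : List ℕ := o.sys.map Prod.fst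

/-- The names of all variables that occur in the differential equation. -/
def ODE.vars (o : ODE S) : Finset ℕ :=
  o.lhs.toFinset ∪ o.sys.foldr (fun p s => p.2.vars ∪ s) ∅

/-- A set of names as a set of ordinary variables. -/
def baseVars (s : Finset ℕ) : Finset Var := s.image Var.base

/-- Bound variables: the variables that some run may change. -/
def Program.bv : Program S → Finset Var
  | .assign x _ => {x}
  | .test _ => ∅
  | .ode o _ => baseVars o.lhs.toFinset ∪ (baseVars o.lhs.toFinset).image Var.prime
  | .choice α β => α.bv ∪ β.bv
  | .seq α β => α.bv ∪ β.bv
  | .star α => α.bv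

/-- Must-bound variables: the variables that are written on every run. -/
def Program.mbv : Program S → Finset Var
  | .assign x _ => {x}
  | .test _ => ∅
  | .ode o _ => baseVars o.lhs.toFinset ∪ (baseVars o.lhs.toFinset).image Var.prime
  | .choice α β => α.mbv ∩ β.mbv
  | .seq α β => α.mbv ∪ β.mbv
  | .star _ => ∅

/-- Free variables of a program. -/
def Program.fv : Program S → Finset Var
  | .assign _ e => baseVars e.vars
  | .test Q => baseVars Q.vars
  | .ode o Q => baseVars (o.vars ∪ Q.vars)
  | .choice α β => α.fv ∪ β.fv
  | .seq α β => α.fv ∪ (β.fv \ α.mbv)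
  | .star α => α.fv

/-- Free variables of a formula. -/
def Formula.fv : Formula S → Finset Var
  | .cmp _ a b => a.fv ∪ b.fv
  | .and φ ψ => φ.fv ∪ ψ.fv
  | .or φ ψ => φ.fv ∪ ψ.fv
  | .not φ => φ.fv
  | .all x φ => φ.fv.erase x
  | .ex x φ => φ.fv.erase x
  | .box α φ => α.fv ∪ (φ.fv \ α.mbv)
  | .dia α φ => α.fv ∪ (φ.fv \ α.mbv)

/-! ### Admissible substitution of an extended term for a variable -/

/-- The replacement that maps `x` to `e` and every other variable to itself. -/
def single (x : Var) (e : ETerm S) (n : ℕ) : ETerm S := if Var.base n = x then e else .var n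

def Term.subst (x : Var) (e : ETerm S) : Term S → Term S
  | .var y => if y = x then e.toTerm else .var y
  | .const c => .const c
  | .add a b => .add (a.subst x e) (b.subst x e)
  | .mul a b => .mul (a.subst x e) (b.subst x e)
  | .app h args => .app h (fun i => (args i).subst x e)
  | .diff t => .diff t

/-- `x` is not free in any differential inside the term. -/
def Term.FreeFor (x : Var) : Term S → Prop
  | .var _ => True
  | .const _ => True
  | .add a b => a.FreeFor x ∧ b.FreeFor x
  | .mul a b => a.FreeFor x ∧ b.FreeFor x
  | .app _ args => ∀ i, (args i).FreeFor x
  | .diff t => x ∉ (Term.diff t).fv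

def ODE.subst (x : Var) (e : ETerm S) (o : ODE S) : ODE S where
  sys := o.sys.map fun p => (p.1, p.2.bind (single x e))
  nodup := by
    have h := o.nodup
    rw [List.map_map]
    exact h

/-- Replace the free occurrences of `x` in a program. -/
def Program.subst (x : Var) (e : ETerm S) : Program S → Program S
  | .assign y t => .assign y (t.bind (single x e))
  | .test Q => .test (Q.bind (single x e))
  | .ode o Q => .ode (o.subst x e) (Q.bind (single x e))
  | .choice α β => .choice (α.subst x e) (β.subst x e)
  | .seq α β => .seq (α.subst x e) (if x ∈ α.mbv then β else β.subst x e)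
  | .star α => .star (α.subst x e)

/-- The program changes neither `x` nor any variable of `e`. -/
def Program.Avoids (x : Var) (e : ETerm S) (α : Program S) : Prop :=
  x ∉ α.bv ∧ ∀ y ∈ baseVars e.vars, y ∉ α.bv

/-- `e` is free for `x` in a program: free occurrences of `x` are replaced only where neither
`x` nor a variable of `e` may have been bound. -/
def Program.FreeFor (x : Var) (e : ETerm S) : Program S → Prop
  | .assign _ _ => True
  | .test _ => True
  | .ode o Q => x ∈ (Program.ode o Q).fv → (Program.ode o Q).Avoids x e
  | .choice α β => α.FreeFor x e ∧ β.FreeFor x e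
  | .seq α β => α.FreeFor x e ∧ (x ∈ β.fv → x ∉ α.mbv → α.Avoids x e ∧ β.FreeFor x e)
  | .star α => x ∈ α.fv → α.Avoids x e ∧ α.FreeFor x e

/-- Replace the free occurrences of `x` in a formula. -/
def Formula.subst (x : Var) (e : ETerm S) : Formula S → Formula S
  | .cmp c a b => .cmp c (a.subst x e) (b.subst x e)
  | .and φ ψ => .and (φ.subst x e) (ψ.subst x e)
  | .or φ ψ => .or (φ.subst x e) (ψ.subst x e)
  | .not φ => .not (φ.subst x e)
  | .all y φ => .all y (if y = x then φ else φ.subst x e)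
  | .ex y φ => .ex y (if y = x then φ else φ.subst x e)
  | .box α φ => .box (α.subst x e) (if x ∈ α.mbv then φ else φ.subst x e)
  | .dia α φ => .dia (α.subst x e) (if x ∈ α.mbv then φ else φ.subst x e)

/-- `e` is free for `x` in a formula. -/
def Formula.FreeFor (x : Var) (e : ETerm S) : Formula S → Prop
  | .cmp _ a b => a.FreeFor x ∧ b.FreeFor x
  | .and φ ψ => φ.FreeFor x e ∧ ψ.FreeFor x e
  | .or φ ψ => φ.FreeFor x e ∧ ψ.FreeFor x e
  | .not φ => φ.FreeFor x e
  | .all y φ => x ∈ φ.fv.erase y → y ∉ baseVars e.vars ∧ φ.FreeFor x e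
  | .ex y φ => x ∈ φ.fv.erase y → y ∉ baseVars e.vars ∧ φ.FreeFor x e
  | .box α φ => α.FreeFor x e ∧ (x ∈ φ.fv → x ∉ α.mbv → α.Avoids x e ∧ φ.FreeFor x e)
  | .dia α φ => α.FreeFor x e ∧ (x ∈ φ.fv → x ∉ α.mbv → α.Avoids x e ∧ φ.FreeFor x e)

/-- `ψ` is an instance `φ(e)` of `φ(x)`; the case `ψ = φ` is the instance of `x` by itself, which
is spelled out because it needs no admissibility and `x` may be a differential variable. -/
def Formula.IsInstance (x : Var) (φ ψ : Formula S) : Prop :=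
  ψ = φ ∨ ∃ e : ETerm S, φ.FreeFor x e ∧ ψ = φ.subst x e

/-- `ψ` is the instance `φ(y)` of `φ(x)` for a variable `y`. -/
def Formula.IsVarInstance (x y : Var) (φ ψ : Formula S) : Prop :=
  (y = x ∧ ψ = φ) ∨
    ∃ n : ℕ, y = Var.base n ∧ φ.FreeFor x (.var n) ∧ ψ = φ.subst x (.var n)

/-! ### First-order real arithmetic -/

/-- Polynomial terms with rational coefficients. -/
inductive RPoly : Type
  | var (n : ℕ) : RPoly
  | const (c : ℚ) : RPoly
  | add (a b : RPoly) : RPoly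
  | mul (a b : RPoly) : RPoly

/-- Formulas of first-order real arithmetic. -/
inductive RFml : Type
  | cmp (c : Cmp) (a b : RPoly) : RFml
  | and (F G : RFml) : RFml
  | or (F G : RFml) : RFml
  | not (F : RFml) : RFml
  | all (n : ℕ) (F : RFml) : RFml
  | ex (n : ℕ) (F : RFml) : RFml

def RPoly.eval (v : ℕ → ℝ) : RPoly → ℝ
  | .var n => v n
  | .const c => (c : ℝ)
  | .add a b => a.eval v + b.eval v
  | .mul a b => a.eval v * b.eval v

def Cmp.holds : Cmp → ℝ → ℝ → Prop
  | .eq, a, b => a = b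
  | .ge, a, b => a ≥ b
  | .gt, a, b => a > b

/-- Truth over the real numbers. -/
def RFml.holds (v : ℕ → ℝ) : RFml → Prop
  | .cmp c a b => c.holds (a.eval v) (b.eval v)
  | .and F G => F.holds v ∧ G.holds v
  | .or F G => F.holds v ∨ G.holds v
  | .not F => ¬ F.holds v
  | .all n F => ∀ r : ℝ, F.holds (Function.update v n r)
  | .ex n F => ∃ r : ℝ, F.holds (Function.update v n r)

def RFml.Valid (F : RFml) : Prop := ∀ v : ℕ → ℝ, F.holds v

def RPoly.fv : RPoly → Finset ℕ
  | .var n => {n}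
  | .const _ => ∅
  | .add a b => a.fv ∪ b.fv
  | .mul a b => a.fv ∪ b.fv

def RFml.fv : RFml → Finset ℕ
  | .cmp _ a b => a.fv ∪ b.fv
  | .and F G => F.fv ∪ G.fv
  | .or F G => F.fv ∪ G.fv
  | .not F => F.fv
  | .all n F => F.fv.erase n
  | .ex n F => F.fv.erase n

def RPoly.inst (σ : ℕ → Term S) : RPoly → Term S
  | .var n => σ n
  | .const c => .const c
  | .add a b => .add (a.inst σ) (b.inst σ)
  | .mul a b => .mul (a.inst σ) (b.inst σ)

/-- Substitution instance: free variables are replaced according to `σ`, and bound variables are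
renamed according to `β`. -/
def RFml.inst (β : ℕ → Var) (σ : ℕ → Term S) : RFml → Formula S
  | .cmp c a b => .cmp c (a.inst σ) (b.inst σ)
  | .and F G => .and (F.inst β σ) (G.inst β σ)
  | .or F G => .or (F.inst β σ) (G.inst β σ)
  | .not F => .not (F.inst β σ)
  | .all n F => .all (β n) (F.inst β (Function.update σ n (.var (β n))))
  | .ex n F => .ex (β n) (F.inst β (Function.update σ n (.var (β n))))

/-- The substitution instance captures no variable. -/
def RFml.InstOK (β : ℕ → Var) (σ : ℕ → Term S) : RFml → Prop
  | .cmp _ _ _ => True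
  | .and F G => F.InstOK β σ ∧ G.InstOK β σ
  | .or F G => F.InstOK β σ ∧ G.InstOK β σ
  | .not F => F.InstOK β σ
  | .all n F => (∀ m ∈ F.fv.erase n, β n ∉ (σ m).fv) ∧
      F.InstOK β (Function.update σ n (.var (β n)))
  | .ex n F => (∀ m ∈ F.fv.erase n, β n ∉ (σ m).fv) ∧
      F.InstOK β (Function.update σ n (.var (β n)))

/-! ### Term languages -/

/-- The value of an extended term in a state, for given interpretations of the function symbols. -/
def ETerm.eval (I : (h : Fin S.num) → (Fin (S.arity h) → ℝ) → ℝ) (v : ℕ → ℝ) : ETerm S → ℝ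
  | .var n => v n
  | .const c => (c : ℝ)
  | .add a b => a.eval I v + b.eval I v
  | .mul a b => a.eval I v * b.eval I v
  | .app h args => I h (fun i => (args i).eval I v)

/-- A term language: function symbols with a fixed smooth interpretation, and for every function
symbol `h` of arity `k` and every `i < k` an extended term `pd h i` in the variables `0, …, k - 1`
that represents the partial derivative of `h` by its argument number `i`. -/
structure TermLanguage extends Signature where
  interp : (h : Fin num) → (Fin (arity h) → ℝ) → ℝ
  smooth : ∀ h, ContDiff ℝ (⊤ : ℕ∞) (interp h)
  pd : (h : Fin num) → Fin (arity h) → ETerm toSignature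
  pd_vars : ∀ h i, ∀ n ∈ (pd h i).vars, n < arity h
  pd_spec : ∀ h i (v : ℕ → ℝ),
    HasDerivAt (fun t : ℝ => interp h (Function.update (fun j : Fin (arity h) => v j) i t))
      ((pd h i).eval interp v) (v i)

/-- Extended terms of a term language. -/
abbrev TermLanguage.ET (L : TermLanguage) : Type := ETerm L.toSignature

/-- The ring of extended terms with variables among `V`: the real-valued functions of the state
that are values of such terms, with the usual addition and multiplication. -/
def TermLanguage.termRing (L : TermLanguage) (V : Finset ℕ) : Subring ((ℕ → ℝ) → ℝ) where
  carrier := {F | ∃ e : L.ET, e.vars ⊆ V ∧ ∀ v, F v = e.eval L.interp v}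
  mul_mem' := by
    rintro F G ⟨a, ha, hF⟩ ⟨b, hb, hG⟩
    exact ⟨.mul a b, Finset.union_subset ha hb, fun v => by simp [ETerm.eval, hF, hG]⟩
  one_mem' := ⟨.const 1, Finset.empty_subset _, fun v => by simp [ETerm.eval]⟩
  add_mem' := by
    rintro F G ⟨a, ha, hF⟩ ⟨b, hb, hG⟩
    exact ⟨.add a b, Finset.union_subset ha hb, fun v => by simp [ETerm.eval, hF, hG]⟩
  zero_mem' := ⟨.const 0, Finset.empty_subset _, fun v => by simp [ETerm.eval]⟩
  neg_mem' := by
    rintro F ⟨a, ha, hF⟩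
    exact ⟨.mul (.const (-1)) a, Finset.union_subset (Finset.empty_subset _) ha,
      fun v => by simp [ETerm.eval, hF]⟩

/-- The term language is Noetherian: over any finitely many variables, the ring of extended terms
is Noetherian. -/
def TermLanguage.IsNoetherian (L : TermLanguage) : Prop :=
  ∀ V : Finset ℕ, IsNoetherianRing (L.termRing V)

/-- The term `g₁ * e₁ + … + gₖ * eₖ + 0`. -/
def combination (gs es : List (ETerm S)) : ETerm S :=
  (List.zipWith ETerm.mul gs es).foldr ETerm.add (.const 0)

/-- `e` lies in the ideal generated by `es` in the ring of extended terms. -/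
def TermLanguage.InIdeal (L : TermLanguage) (e : L.ET) (es : List L.ET) : Prop :=
  ∃ gs : List L.ET, gs.length = es.length ∧
    ∀ v, e.eval L.interp v = (combination gs es).eval L.interp v

/-! ### The proof calculus -/

/-- The negation of an extended term. -/
def ETerm.neg (e : ETerm S) : ETerm S := .mul (.const (-1)) e

/-- The sum of finitely many terms. -/
def Term.sum (l : List (Term S)) : Term S := l.foldr Term.add (.const 0)

/-- The vectorial equation stating that every variable `n` in the list equals `ρ n`. -/
def eqVec (l : List ℕ) (ρ : ℕ → ℕ) : SFml S :=
  l.foldr (fun n F => .and (.cmp .eq (.var n) (.var (ρ n))) F) .tru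

/-- Universal quantification over a vector of variables. -/
def allVec (l : List ℕ) (φ : Formula S) : Formula S :=
  l.foldr (fun n ψ => .all (Var.base n) ψ) φ

/-- Assign to the differential variables on the left-hand side of the differential equation their
right-hand sides. As the latter are free of differential variables, the order is irrelevant. -/
def ODE.assignDiffs (o : ODE S) (φ : Formula S) : Formula S :=
  o.sys.foldr (fun p ψ => .box (.assign (Var.base p.1).prime p.2) ψ) φ

/-- The differential equation has a clock, so that it has no fixpoints. -/
def ODE.HasClock (o : ODE S) : Prop := ∃ p ∈ o.sys, p.2 = .const 1

/-- `ρ` maps the evolving variables to distinct variables that are fresh for the differential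
equation and for `V`. -/
def ODE.FreshCopy (o : ODE S) (ρ : ℕ → ℕ) (V : Finset ℕ) : Prop :=
  (o.lhs.map ρ).Nodup ∧ ∀ n ∈ o.lhs, ρ n ∉ o.vars ∪ V

/-- `r` has the form `a * y + b` where `y` does not occur in `a` and `b`; a vanishing summand may be
left out. -/
def ETerm.IsAffineIn (y : ℕ) (r : ETerm S) : Prop :=
  ∃ a b : ETerm S, y ∉ a.vars ∧ y ∉ b.vars ∧
    (r = .add (.mul a (.var y)) b ∨ r = .mul a (.var y) ∨ r = b)

/-- Replace the evolving variables by their copies. -/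
def ODE.ren (o : ODE S) (ρ : ℕ → ℕ) (n : ℕ) : ETerm S :=
  if n ∈ o.lhs then .var (ρ n) else .var n

open Formula in
/-- The axioms. -/
inductive Axiom (L : TermLanguage) : Formula L.toSignature → Prop
  -- differentials
  | diff_const (c : ℚ) : Axiom L (eq (.diff (.const c)) (.const 0))
  | diff_var (x : Var) : Axiom L (eq (.diff (.var x)) (.var x.prime))
  | diff_add (a b : Term L.toSignature) :
      Axiom L (eq (.diff (.add a b)) (.add (.diff a) (.diff b)))
  | diff_mul (a b : Term L.toSignature) :
      Axiom L (eq (.diff (.mul a b)) (.add (.mul (.diff a) b) (.mul a (.diff b))))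
  | diff_app (h : Fin L.num) (args : Fin (L.arity h) → Term L.toSignature) :
      Axiom L (eq (.diff (.app h args)) (Term.sum (List.ofFn fun i =>
        .mul ((L.pd h i).inst fun n => if hn : n < L.arity h then args ⟨n, hn⟩ else .const 0)
          (.diff (args i)))))
  -- modalities
  | dual (α : Program L.toSignature) (φ) : Axiom L (iff (.dia α φ) (.not (.box α (.not φ))))
  | K (α : Program L.toSignature) (φ ψ) :
      Axiom L (imp (.box α (imp φ ψ)) (imp (.box α φ) (.box α ψ)))
  | V (α : Program L.toSignature) (φ) (h : Disjoint φ.fv α.bv) : Axiom L (imp φ (.box α φ))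
  -- hybrid programs
  | assign (x : Var) (e : L.ET) (φ) (h : φ.FreeFor x e) :
      Axiom L (iff (.box (.assign x e) φ) (φ.subst x e))
  | test (Q : SFml L.toSignature) (φ) : Axiom L (iff (.box (.test Q) φ) (imp Q.toFormula φ))
  | choice (α β : Program L.toSignature) (φ) :
      Axiom L (iff (.box (.choice α β) φ) (.and (.box α φ) (.box β φ)))
  | compose (α β : Program L.toSignature) (φ) :
      Axiom L (iff (.box (.seq α β) φ) (.box α (.box β φ)))
  | iterate (α : Program L.toSignature) (φ) :
      Axiom L (iff (.box (.star α) φ) (.and φ (.box α (.box (.star α) φ))))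
  | induction (α : Program L.toSignature) (φ) :
      Axiom L (iff (.box (.star α) φ) (.and φ (.box (.star α) (imp φ (.box α φ)))))
  -- differential effect, weakening, skip, modus ponens for domains, cut
  | DE (o : ODE L.toSignature) (Q) (φ) :
      Axiom L (iff (.box (.ode o Q) φ) (.box (.ode o Q) (o.assignDiffs φ)))
  | DW (o : ODE L.toSignature) (Q) : Axiom L (.box (.ode o Q) Q.toFormula)
  | DX (o : ODE L.toSignature) (Q) (φ) (h : ∀ n ∈ o.lhs, (Var.base n).prime ∉ φ.fv) :
      Axiom L (iff (.box (.ode o Q) φ) (imp Q.toFormula (.and φ (.box (.ode o Q) φ))))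
  | DMP (o : ODE L.toSignature) (Q R) (φ) :
      Axiom L (imp (.box (.ode o Q) (imp Q.toFormula R.toFormula))
        (imp (.box (.ode o R) φ) (.box (.ode o Q) φ)))
  | DC (o : ODE L.toSignature) (Q R) (φ) :
      Axiom L (imp (.box (.ode o Q) R.toFormula)
        (iff (.box (.ode o Q) φ) (.box (.ode o (.and Q R)) φ)))
  -- differential ghosts: `o'` extends `o` by an equation for the fresh variable `y` that is
  -- affine in `y`
  | DG_ex (o o' : ODE L.toSignature) (Q) (φ) (y : ℕ) (r : L.ET)
      (hr : r.IsAffineIn y) (ho : o'.sys = o.sys ++ [(y, r)]) (hy : y ∉ o.vars ∪ Q.vars)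
      (hφ : Var.base y ∉ φ.fv) (hφ' : (Var.base y).prime ∉ φ.fv) :
      Axiom L (iff (.box (.ode o Q) φ) (.ex (Var.base y) (.box (.ode o' Q) φ)))
  | DG_all (o o' : ODE L.toSignature) (Q) (φ) (y : ℕ) (r : L.ET)
      (hr : r.IsAffineIn y) (ho : o'.sys = o.sys ++ [(y, r)]) (hy : y ∉ o.vars ∪ Q.vars)
      (hφ : Var.base y ∉ φ.fv) (hφ' : (Var.base y).prime ∉ φ.fv) :
      Axiom L (iff (.box (.ode o Q) φ) (.all (Var.base y) (.box (.ode o' Q) φ)))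
  -- Barcan
  | barcan (o : ODE L.toSignature) (Q) (y : Var) (φ)
      (hy : y ∉ (Program.ode o Q).fv ∪ (Program.ode o Q).bv) :
      Axiom L (iff (.dia (.ode o Q) (.ex y φ)) (.ex y (.dia (.ode o Q) φ)))
  -- uniqueness, continuous existence, differential adjoints
  | uniq (o : ODE L.toSignature) (Q₁ Q₂) (φ) :
      Axiom L (iff (.dia (.ode o (.and Q₁ Q₂)) φ)
        (.and (.dia (.ode o Q₁) φ) (.dia (.ode o Q₂) φ)))
  | cont (o : ODE L.toSignature) (e : L.ET) (ρ : ℕ → ℕ) (hc : o.HasClock)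
      (hρ : o.FreshCopy ρ e.vars) :
      Axiom L (imp (eqVec o.lhs ρ).toFormula
        (iff (.dia (.ode o (.cmp .gt e (.const 0))) (.not (eqVec o.lhs ρ).toFormula))
          (.cmp .gt e.toTerm (.const 0))))
  | adjoint (o o' : ODE L.toSignature) (Q) (ρ : ℕ → ℕ) (hρ : o.FreshCopy ρ Q.vars)
      (ho : o'.sys = o.sys.map fun p => (ρ p.1, (p.2.bind (o.ren ρ)).neg)) :
      Axiom L (iff (.dia (.ode o Q) (eqVec o.lhs ρ).toFormula)
        (.dia (.ode o' (Q.bind (o.ren ρ))) (eqVec o.lhs ρ).toFormula))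
  -- real induction, without and with a domain constraint
  | real_induction (o : ODE L.toSignature) (P) (ρ : ℕ → ℕ) (hc : o.HasClock)
      (hρ : o.FreshCopy ρ P.vars) :
      Axiom L (iff (.box (.ode o .tru) P.toFormula)
        (allVec (o.lhs.map ρ) (.box (.ode o (.or P (eqVec o.lhs ρ)))
          (imp (eqVec o.lhs ρ).toFormula
            (.and P.toFormula (.dia (.ode o (.or P (eqVec o.lhs ρ)))
              (.not (eqVec o.lhs ρ).toFormula)))))))
  | real_induction_dom (o : ODE L.toSignature) (P Q) (ρ : ℕ → ℕ) (hc : o.HasClock)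
      (hρ : o.FreshCopy ρ (P.vars ∪ Q.vars)) :
      Axiom L (iff (.box (.ode o Q) P.toFormula)
        (allVec (o.lhs.map ρ) (.box (.ode o (.and Q (.or P (eqVec o.lhs ρ))))
          (imp (eqVec o.lhs ρ).toFormula
            (.and P.toFormula
              (imp
                (.dia (.ode o (.or Q (eqVec o.lhs ρ))) (.not (eqVec o.lhs ρ).toFormula))
                (.dia (.ode o (.or P (eqVec o.lhs ρ))) (.not (eqVec o.lhs ρ).toFormula))))))))

open Formula in
/-- Derivability of sequents in the calculus of differential dynamic logic. -/
inductive Provable (L : TermLanguage) :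
    List (Formula L.toSignature) → Formula L.toSignature → Prop
  | ax {Γ φ} (h : Axiom L φ) : Provable L Γ φ
  -- structural and propositional rules
  | hyp {Γ φ} (h : φ ∈ Γ) : Provable L Γ φ
  | weaken {Γ Δ φ} (h : Γ ⊆ Δ) (d : Provable L Γ φ) : Provable L Δ φ
  | cut {Γ φ} (ψ) (d₁ : Provable L Γ ψ) (d₂ : Provable L (ψ :: Γ) φ) : Provable L Γ φ
  | flsL {Γ φ} : Provable L (fls :: Γ) φ
  | notL {Γ φ} (d : Provable L Γ φ) : Provable L (.not φ :: Γ) fls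
  | notR {Γ φ} (d : Provable L (φ :: Γ) fls) : Provable L Γ (.not φ)
  | andL {Γ φ₁ φ₂ ψ} (d : Provable L (φ₁ :: φ₂ :: Γ) ψ) : Provable L (.and φ₁ φ₂ :: Γ) ψ
  | andR {Γ φ₁ φ₂} (d₁ : Provable L Γ φ₁) (d₂ : Provable L Γ φ₂) : Provable L Γ (.and φ₁ φ₂)
  | orL {Γ φ₁ φ₂ ψ} (d₁ : Provable L (φ₁ :: Γ) ψ) (d₂ : Provable L (φ₂ :: Γ) ψ) :
      Provable L (.or φ₁ φ₂ :: Γ) ψ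
  | orR₁ {Γ φ₁ φ₂} (d : Provable L Γ φ₁) : Provable L Γ (.or φ₁ φ₂)
  | orR₂ {Γ φ₁ φ₂} (d : Provable L Γ φ₂) : Provable L Γ (.or φ₁ φ₂)
  | impL {Γ φ₁ φ₂ ψ} (d₁ : Provable L Γ φ₁) (d₂ : Provable L (φ₂ :: Γ) ψ) :
      Provable L (imp φ₁ φ₂ :: Γ) ψ
  | impR {Γ φ₁ φ₂} (d : Provable L (φ₁ :: Γ) φ₂) : Provable L Γ (imp φ₁ φ₂)
  -- first-order rules
  | allL {Γ x φ φ' ψ} (h : IsInstance x φ φ') (d : Provable L (φ' :: Γ) ψ) :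
      Provable L (.all x φ :: Γ) ψ
  | exR {Γ x φ φ'} (h : IsInstance x φ φ') (d : Provable L Γ φ') : Provable L Γ (.ex x φ)
  | allR {Γ x φ φ'} (y : Var) (h : IsVarInstance x y φ φ') (hΓ : ∀ χ ∈ Γ, y ∉ χ.fv)
      (hφ : y ∉ (Formula.all x φ).fv) (d : Provable L Γ φ') : Provable L Γ (.all x φ)
  | exL {Γ x φ φ' ψ} (y : Var) (h : IsVarInstance x y φ φ') (hΓ : ∀ χ ∈ Γ, y ∉ χ.fv)
      (hφ : y ∉ (Formula.ex x φ).fv) (hψ : y ∉ ψ.fv) (d : Provable L (φ' :: Γ) ψ) :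
      Provable L (.ex x φ :: Γ) ψ
  -- congruence of equality for function symbols
  | congr {Γ} (h : Fin L.num) (args args' : Fin (L.arity h) → Term L.toSignature)
      (d : ∀ i, Provable L Γ (eq (args i) (args' i))) :
      Provable L Γ (eq (.app h args) (.app h args'))
  -- real arithmetic: substitution instances of valid formulas of first-order real arithmetic
  | real {Γ} (F : RFml) (β : ℕ → Var) (σ : ℕ → Term L.toSignature) (hF : F.Valid)
      (hσ : F.InstOK β σ) : Provable L Γ (F.inst β σ)
  -- generalization and differential weakening
  | G {Γ φ} (α : Program L.toSignature) (d : Provable L [] φ) : Provable L Γ (.box α φ)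
  | dW {Γ φ} (o : ODE L.toSignature) (Q) (d : Provable L [Q.toFormula] φ) :
      Provable L Γ (.box (.ode o Q) φ)
  -- differential invariants: variables of `e` that do not evolve must have differential zero
  -- (there are none if `e` depends on the evolving variables only)
  | DI_eq {Γ} (o : ODE L.toSignature) (Q) (e : L.ET)
      (d : ∀ n ∈ e.vars, n ∉ o.lhs →
        Provable L Γ (eq (.var (Var.base n).prime) (.const 0))) :
      Provable L Γ (imp (.box (.ode o Q) (eq (.diff e.toTerm) (.const 0)))
        (iff (.box (.ode o Q) (eq e.toTerm (.const 0)))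
          (imp Q.toFormula (eq e.toTerm (.const 0)))))
  | DI_cmp {Γ} (c : Cmp) (hc : c = .ge ∨ c = .gt) (o : ODE L.toSignature) (Q) (e : L.ET)
      (d : ∀ n ∈ e.vars, n ∉ o.lhs →
        Provable L Γ (eq (.var (Var.base n).prime) (.const 0))) :
      Provable L Γ (imp (.box (.ode o Q) (.cmp .ge (.diff e.toTerm) (.const 0)))
        (iff (.box (.ode o Q) (.cmp c e.toTerm (.const 0)))
          (imp Q.toFormula (.cmp c e.toTerm (.const 0)))))

/-! ### Gödel numbers and algorithms -/

def ETerm.code : ETerm S → ℕ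
  | .var n => Nat.pair 0 n
  | .const c => Nat.pair 1 (Nat.pair (Encodable.encode c.num) c.den)
  | .add a b => Nat.pair 2 (Nat.pair a.code b.code)
  | .mul a b => Nat.pair 3 (Nat.pair a.code b.code)
  | .app h args => Nat.pair 4 (Nat.pair h (Encodable.encode (List.ofFn fun i => (args i).code)))

def Cmp.code : Cmp → ℕ
  | .eq => 0
  | .ge => 1
  | .gt => 2

def SFml.code : SFml S → ℕ
  | .cmp c a b => Nat.pair 0 (Nat.pair c.code (Nat.pair a.code b.code))
  | .and P Q => Nat.pair 1 (Nat.pair P.code Q.code)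
  | .or P Q => Nat.pair 2 (Nat.pair P.code Q.code)
  | .not P => Nat.pair 3 P.code

def ODE.code (o : ODE S) : ℕ :=
  Encodable.encode (o.sys.map fun p => Nat.pair p.1 p.2.code)

def Program.code : Program S → ℕ
  | .assign x e => Nat.pair 0 (Nat.pair (Nat.pair x.name x.ord) e.code)
  | .test Q => Nat.pair 1 Q.code
  | .ode o Q => Nat.pair 2 (Nat.pair o.code Q.code)
  | .choice α β => Nat.pair 3 (Nat.pair α.code β.code)
  | .seq α β => Nat.pair 4 (Nat.pair α.code β.code)
  | .star α => Nat.pair 5 α.code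

/-- There is an algorithm that decides, and proves, ideal membership of extended terms: on input
`e` and `es` it terminates, and either it returns cofactors together with which the identity
`e = g₁ * e₁ + … + gₖ * eₖ` is derivable, or it reports that `e` is not in the ideal generated by
`es`, and is right about that. -/
def TermLanguage.DecidesIdealMembership (L : TermLanguage) : Prop :=
  ∃ M : ℕ →. ℕ, Partrec M ∧ ∀ (e : L.ET) (es : List L.ET), ∃ r : Option (List L.ET),
    Encodable.encode (r.map (List.map ETerm.code)) ∈
      M (Nat.pair e.code (Encodable.encode (es.map ETerm.code))) ∧
    match r with
    | some gs => gs.length = es.length ∧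
        Provable L [] (.eq e.toTerm (combination gs es).toTerm)
    | none => ¬ L.InIdeal e es

end DL

/-! Modulo real arithmetic an analytic formula is a single equation `t = 0`: sums of squares express
conjunctions and products express disjunctions. So it suffices to compute, by recursion on the
program, a term whose vanishing is derivably equivalent to `[α] t = 0`. Assignments substitute, a
test given by `a ≠ 0` multiplies by `a`, choices add squares and compositions compose. Differential
equations and loops need ideals.

For a differential equation with domain `a ≠ 0`, let `p₀ = p, p₁, p₂, …` be the iterated Lie
derivatives of `p`. By the Noetherian property (`exists_inIdeal`) some `pₙ₊₁` lies in the ideal of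
`p₀, …, pₙ`, and the membership algorithm supplies a derivable identity. Put `w = p₀² + … + pₙ²`.
The identity gives `w' ≤ g w` for a term `g`, so `w` stays zero if it starts at zero; this Grönwall
argument is carried out with differential ghosts in `box_eq_zero_of_orbit`. Conversely, if `p` stays
zero on the open domain, then every `pₖ` is zero initially (`orbit_eq_zero`). Otherwise let `pₖ` be
the first nonzero one, `s = ±1` its sign and `r` the squared distance from the initial point. The
`k`-th Lie derivative of `s p - r ^ (k + 1)` is positive at the start and the lower ones vanish, so
`s p - r ^ (k + 1) ≥ 0` for a while. As `p = 0`, this keeps the state at its initial point, although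
continuous existence lets it move (`not_lie_pos`). Hence `[x' = f & a ≠ 0] p = 0` is equivalent to
`a * w = 0` (`box_ode_iff`).

For a loop, let `F` map `e` to the term computed for `[α] e = 0`. Some `F^[n + 1] t` lies in the
ideal of the earlier iterates, and the joint vanishing of those is then a loop invariant, which is
also necessary (`box_star_iff`).

The algorithm lengthens the orbit until the membership algorithm returns cofactors. Negative answers
are correct, so the search cannot outlast the first `n` with membership. Noetherianity concerns
finitely many variables, so the induction in `exists_algorithm` also bounds the variables of the
computed terms. Computability comes from a small recursive language, `RecExpr`, and Kleene's
recursion theorem. -/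

namespace DL

variable {S : Signature}

/-! ### Abstract evaluation: terms as polynomials in their non-polynomial subterms -/

/-- Evaluate a term as a polynomial, with arbitrary values for variables, applications and
differentials. -/
def Term.aeval (v : Term S → ℝ) : Term S → ℝ
  | .var x => v (.var x)
  | .const c => (c : ℝ)
  | .add a b => a.aeval v + b.aeval v
  | .mul a b => a.aeval v * b.aeval v
  | .app h args => v (.app h args)
  | .diff e => v (.diff e)

/-- Abstract truth of a formula without quantifiers and modalities. -/
def Formula.aholds (v : Term S → ℝ) : Formula S → Prop
  | .cmp c a b => c.holds (a.aeval v) (b.aeval v)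
  | .and φ ψ => φ.aholds v ∧ ψ.aholds v
  | .or φ ψ => φ.aholds v ∨ ψ.aholds v
  | .not φ => ¬ φ.aholds v
  | .all _ _ | .ex _ _ | .box _ _ | .dia _ _ => False

/-- No quantifiers and no modalities. -/
def Formula.QF : Formula S → Prop
  | .cmp _ _ _ => True
  | .and φ ψ => φ.QF ∧ ψ.QF
  | .or φ ψ => φ.QF ∧ ψ.QF
  | .not φ => φ.QF
  | .all _ _ | .ex _ _ | .box _ _ | .dia _ _ => False

/-- Names the arithmetic variable that stands for a non-polynomial subterm; only injectivity
matters. -/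
def Term.code : Term S → ℕ
  | .var x => Nat.pair 0 (Nat.pair x.name x.ord)
  | .const c => Nat.pair 1 (Encodable.encode c)
  | .add a b => Nat.pair 2 (Nat.pair a.code b.code)
  | .mul a b => Nat.pair 3 (Nat.pair a.code b.code)
  | .app h args => Nat.pair 4 (Nat.pair h (Encodable.encode (List.ofFn fun i => (args i).code)))
  | .diff e => Nat.pair 5 e.code

theorem Term.code_injective : Function.Injective (Term.code (S := S)) := by
  intro a
  induction a with
  | var x =>
    intro b h
    cases b <;> simp [Term.code] at h
    rename_i y
    obtain ⟨_, _⟩ := x; obtain ⟨_, _⟩ := y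
    simp_all
  | const c => intro b h; cases b <;> simp [Term.code] at h; rw [h]
  | add a b iha ihb =>
    intro t h; cases t <;> simp [Term.code] at h
    rw [iha h.1, ihb h.2]
  | mul a b iha ihb =>
    intro t h; cases t <;> simp [Term.code] at h
    rw [iha h.1, ihb h.2]
  | app f args ih =>
    intro t h; cases t <;> simp [Term.code] at h
    rename_i f' args'
    obtain ⟨h1, h2⟩ := h
    have h1 : f = f' := Fin.ext h1
    subst h1
    congr 1
    funext i
    exact ih i (congrFun (List.ofFn_injective h2) i)
  | diff e ih => intro t h; cases t <;> simp [Term.code] at h; rw [ih h]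

/-- A term as a polynomial whose variables are codes of non-polynomial subterms. -/
def Term.toRPoly : Term S → RPoly
  | .const c => .const c
  | .add a b => .add a.toRPoly b.toRPoly
  | .mul a b => .mul a.toRPoly b.toRPoly
  | t => .var t.code

def Formula.toRFml : Formula S → RFml
  | .cmp c a b => .cmp c a.toRPoly b.toRPoly
  | .and φ ψ => .and φ.toRFml ψ.toRFml
  | .or φ ψ => .or φ.toRFml ψ.toRFml
  | .not φ => .not φ.toRFml
  | .all _ φ | .ex _ φ | .box _ φ | .dia _ φ => φ.toRFml

theorem Term.toRPoly_inst (σ : ℕ → Term S) (hσ : ∀ t : Term S, σ t.code = t) (t : Term S) :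
    t.toRPoly.inst σ = t := by
  induction t <;> simp_all [Term.toRPoly, RPoly.inst]

theorem Term.toRPoly_eval (w : ℕ → ℝ) (t : Term S) :
    t.toRPoly.eval w = t.aeval (fun s => w s.code) := by
  induction t <;> simp_all [Term.toRPoly, RPoly.eval, Term.aeval]

theorem Formula.toRFml_inst (β : ℕ → Var) (σ : ℕ → Term S) (hσ : ∀ t : Term S, σ t.code = t)
    (φ : Formula S) (hφ : φ.QF) : φ.toRFml.inst β σ = φ := by
  induction φ <;> simp_all [Formula.toRFml, RFml.inst, Formula.QF, Term.toRPoly_inst]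

theorem Formula.toRFml_holds (w : ℕ → ℝ) (φ : Formula S) (hφ : φ.QF) :
    φ.toRFml.holds w ↔ φ.aholds (fun s => w s.code) := by
  induction φ <;>
    simp_all [Formula.toRFml, RFml.holds, Formula.QF, Formula.aholds, Term.toRPoly_eval]

theorem Formula.toRFml_instOK (β : ℕ → Var) (σ : ℕ → Term S) (φ : Formula S) (hφ : φ.QF) :
    φ.toRFml.InstOK β σ := by
  induction φ <;> simp_all [Formula.toRFml, RFml.InstOK, Formula.QF]

@[simp] theorem Formula.aholds_imp (v : Term S → ℝ) (φ ψ : Formula S) :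
    (φ.imp ψ).aholds v ↔ (φ.aholds v → ψ.aholds v) := by
  simp [Formula.imp, Formula.aholds, imp_iff_not_or]

@[simp] theorem Formula.aholds_iff (v : Term S → ℝ) (φ ψ : Formula S) :
    (φ.iff ψ).aholds v ↔ (φ.aholds v ↔ ψ.aholds v) := by
  rw [Formula.iff, Formula.aholds, aholds_imp, aholds_imp]
  tauto

@[simp] theorem Formula.aholds_eq (v : Term S → ℝ) (a b : Term S) :
    (Formula.eq a b).aholds v ↔ a.aeval v = b.aeval v := Iff.rfl

@[simp] theorem Formula.qf_imp {φ ψ : Formula S} : (φ.imp ψ).QF ↔ φ.QF ∧ ψ.QF := Iff.rfl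

@[simp] theorem Formula.qf_eq (a b : Term S) : (Formula.eq a b).QF := trivial

@[simp] theorem Formula.qf_cmp (c : Cmp) (a b : Term S) : (Formula.cmp c a b).QF := trivial

/-! ### Derived rules -/

namespace Provable

variable {L : TermLanguage} {Γ Δ : List (Formula L.toSignature)} {φ ψ χ : Formula L.toSignature}

open Formula

/-- The gateway to real arithmetic: abstract every non-polynomial subterm by the variable numbered
by its code, then instantiate each such variable by the term it encodes. Injectivity of the codes
makes the instance literally `φ`, and without quantifiers nothing can be captured. -/
theorem of_valid (hφ : φ.QF) (h : ∀ v, φ.aholds v) : Provable L Γ φ := by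
  have : Nonempty (Term L.toSignature) := ⟨.const 0⟩
  have hσ : ∀ t : Term L.toSignature, Function.invFun Term.code t.code = t :=
    Function.leftInverse_invFun Term.code_injective
  have := Provable.real (L := L) (Γ := Γ) φ.toRFml (fun _ => Var.base 0) (Function.invFun Term.code)
    (fun w => (φ.toRFml_holds w hφ).2 (h _)) (φ.toRFml_instOK _ _ hφ)
  rwa [φ.toRFml_inst _ _ hσ hφ] at this

theorem mp (h : Provable L Γ (imp φ ψ)) (h' : Provable L Γ φ) : Provable L Γ ψ :=
  .cut _ h (.impL h' (.hyp (List.mem_cons_self ..)))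

theorem cons (h : Provable L Γ φ) : Provable L (ψ :: Γ) φ :=
  .weaken (List.subset_cons_self ..) h

theorem closed (h : Provable L [] φ) : Provable L Γ φ := .weaken (List.nil_subset _) h

theorem head : Provable L (φ :: Γ) φ := .hyp (List.mem_cons_self ..)

/-- Real arithmetic with non-polynomial subterms abstracted. -/
theorem arith (Hs : List (Formula L.toSignature)) (hH : ∀ γ ∈ Hs, Provable L Γ γ)
    (hq : ∀ γ ∈ Hs, γ.QF) (hφ : φ.QF) (h : ∀ v, (∀ γ ∈ Hs, γ.aholds v) → φ.aholds v) :
    Provable L Γ φ := by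
  induction Hs generalizing φ with
  | nil => exact of_valid hφ fun v => h v (by simp)
  | cons γ Hs ih =>
    refine mp (φ := γ) (ih (fun δ hδ => hH δ (by simp [hδ])) (fun δ hδ => hq δ (by simp [hδ]))
      (qf_imp.2 ⟨hq γ (by simp), hφ⟩) fun v hv => ?_) (hH γ (by simp))
    rw [aholds_imp]
    intro hγ
    exact h v (by simpa [hγ] using hv)

theorem arith_one (d : Provable L Γ ψ) (hψ : ψ.QF) (hφ : φ.QF)
    (h : ∀ v, ψ.aholds v → φ.aholds v) : Provable L Γ φ :=
  arith [ψ] (by simpa using d) (by simpa using hψ) hφ (by simpa using h)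

theorem arith_two (d₁ : Provable L Γ ψ) (d₂ : Provable L Γ χ) (hψ : ψ.QF) (hχ : χ.QF) (hφ : φ.QF)
    (h : ∀ v, ψ.aholds v → χ.aholds v → φ.aholds v) : Provable L Γ φ :=
  arith [ψ, χ] (by simp [d₁, d₂]) (by simp [hψ, hχ]) hφ (by simpa using h)

theorem arith_three {θ : Formula L.toSignature} (d₁ : Provable L Γ ψ) (d₂ : Provable L Γ χ)
    (d₃ : Provable L Γ θ) (hψ : ψ.QF) (hχ : χ.QF) (hθ : θ.QF) (hφ : φ.QF)
    (h : ∀ v, ψ.aholds v → χ.aholds v → θ.aholds v → φ.aholds v) : Provable L Γ φ :=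
  arith [ψ, χ, θ] (by simp [d₁, d₂, d₃]) (by simp [hψ, hχ, hθ]) hφ (by simpa using h)

theorem of_fls (h : Provable L Γ fls) : Provable L Γ φ := .cut _ h .flsL

theorem fls_of_not (h : Provable L Γ (.not φ)) (h' : Provable L Γ φ) : Provable L Γ fls :=
  .cut _ h (.notL h')

theorem em (φ : Formula L.toSignature) : Provable L Γ (.or (.not φ) φ) :=
  Provable.impR (φ₁ := φ) (φ₂ := φ) head

theorem cases_on (φ : Formula L.toSignature) (h₁ : Provable L (φ :: Γ) ψ)
    (h₂ : Provable L (.not φ :: Γ) ψ) : Provable L Γ ψ :=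
  .cut _ (em φ) (.orL h₂ h₁)

theorem by_contra (h : Provable L (.not φ :: Γ) fls) : Provable L Γ φ :=
  cases_on φ head (of_fls h)

theorem and_left (h : Provable L Γ (.and φ ψ)) : Provable L Γ φ := .cut _ h (.andL head)

theorem and_right (h : Provable L Γ (.and φ ψ)) : Provable L Γ ψ := .cut _ h (.andL head.cons)

theorem iff_mp (h : Provable L Γ (iff φ ψ)) (h' : Provable L Γ φ) : Provable L Γ ψ :=
  mp (and_left h) h'

theorem iff_mpr (h : Provable L Γ (iff φ ψ)) (h' : Provable L Γ ψ) : Provable L Γ φ :=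
  mp (and_right h) h'

theorem iff_intro (h : Provable L (φ :: Γ) ψ) (h' : Provable L (ψ :: Γ) φ) :
    Provable L Γ (iff φ ψ) :=
  .andR (.impR h) (.impR h')

theorem iff_trans (h : Provable L Γ (iff φ ψ)) (h' : Provable L Γ (iff ψ χ)) :
    Provable L Γ (iff φ χ) :=
  iff_intro (iff_mp h'.cons (iff_mp h.cons head)) (iff_mpr h.cons (iff_mpr h'.cons head))

theorem of_hyps (h : Provable L Δ φ) (hΔ : ∀ δ ∈ Δ, Provable L Γ δ) : Provable L Γ φ := by
  induction Δ generalizing φ with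
  | nil => exact closed h
  | cons δ Δ ih =>
    exact mp (ih (.impR h) fun γ hγ => hΔ γ (by simp [hγ])) (hΔ δ (by simp))

/-- Everything derivable from postconditions is a postcondition. -/
theorem box_mono (α : Program L.toSignature) (Ψ : List (Formula L.toSignature))
    (hΨ : ∀ χ ∈ Ψ, Provable L Γ (.box α χ)) (h : Provable L Ψ φ) : Provable L Γ (.box α φ) := by
  induction Ψ generalizing φ with
  | nil => exact .G α h
  | cons χ Ψ ih =>
    exact mp (mp (.ax (.K α χ φ)) (ih (fun θ hθ => hΨ θ (by simp [hθ])) (.impR h)))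
      (hΨ χ (by simp))

theorem box_one {α : Program L.toSignature} (d : Provable L Γ (.box α ψ))
    (h : Provable L [ψ] φ) : Provable L Γ (.box α φ) :=
  box_mono α [ψ] (by simpa using d) h

theorem box_two {α : Program L.toSignature} (d₁ : Provable L Γ (.box α ψ))
    (d₂ : Provable L Γ (.box α χ)) (h : Provable L [ψ, χ] φ) : Provable L Γ (.box α φ) :=
  box_mono α [ψ, χ] (by simp [d₁, d₂]) h

theorem box_iff {α : Program L.toSignature} (h : Provable L [] (iff φ ψ)) :
    Provable L Γ (iff (.box α φ) (.box α ψ)) :=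
  iff_intro (box_one head (iff_mp h.closed head)) (box_one head (iff_mpr h.closed head))

/-- A fresh variable may be assumed to have the value of any term. -/
theorem fresh (z : Var) (t : Term L.toSignature) (hz : z ∉ t.fv) (hΓ : ∀ χ ∈ Γ, z ∉ χ.fv)
    (hφ : z ∉ φ.fv) (h : Provable L (eq (.var z) t :: Γ) φ) : Provable L Γ φ := by
  -- An instance of `∃ x₀, x₀ = x₁`, with `x₀` renamed to `z` and `x₁` replaced by `t`; `z ∉ t.fv`
  -- excludes capture.
  have hex : Provable L Γ (.ex z (eq (.var z) t)) := by
    have := Provable.real (L := L) (Γ := Γ) (.ex 0 (.cmp .eq (.var 0) (.var 1))) (fun _ => z)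
      (fun _ => t) (fun v => ⟨v 1, by simp [RFml.holds, RPoly.eval, Cmp.holds]⟩)
      (by simp [RFml.InstOK, RFml.fv, RPoly.fv, hz])
    simpa [RFml.inst, RPoly.inst, Function.update, Formula.eq] using this
  refine .cut _ hex (.exL z (.inl ⟨rfl, rfl⟩) hΓ ?_ hφ h)
  simp [Formula.fv]

theorem all_self {x : Var} (h : Provable L Γ (.all x φ)) : Provable L Γ φ :=
  .cut _ h (.allL (.inl rfl) head)

theorem ex_self {x : Var} (h : Provable L Γ φ) : Provable L Γ (.ex x φ) := .exR (.inl rfl) h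

end Provable

/-! ### Syntactic lemmas -/

namespace ETerm

@[simp] theorem toTerm_var (n : ℕ) : (var n : ETerm S).toTerm = .var (Var.base n) := rfl
@[simp] theorem toTerm_const (c : ℚ) : (const c : ETerm S).toTerm = .const c := rfl
@[simp] theorem toTerm_add (a b : ETerm S) : (add a b).toTerm = .add a.toTerm b.toTerm := rfl
@[simp] theorem toTerm_mul (a b : ETerm S) : (mul a b).toTerm = .mul a.toTerm b.toTerm := rfl
theorem toTerm_app (h : Fin S.num) (args : Fin (S.arity h) → ETerm S) :
    (app h args).toTerm = .app h (fun i => (args i).toTerm) := rfl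

theorem fv_toTerm (e : ETerm S) : e.toTerm.fv = baseVars e.vars := by
  induction e with
  | var n => simp [Term.fv, vars, baseVars]
  | const c => simp [Term.fv, vars, baseVars]
  | add a b iha ihb => simp_all [Term.fv, vars, baseVars, Finset.image_union]
  | mul a b iha ihb => simp_all [Term.fv, vars, baseVars, Finset.image_union]
  | app h args ih =>
    simp only [toTerm_app, Term.fv, vars, ih, baseVars]
    ext x
    simp only [Finset.mem_biUnion, Finset.mem_image]
    tauto

theorem ord_of_mem_fv {e : ETerm S} {x : Var} (h : x ∈ e.toTerm.fv) : x.ord = 0 := by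
  rw [fv_toTerm, baseVars, Finset.mem_image] at h
  obtain ⟨n, -, rfl⟩ := h
  rfl

theorem base_mem_fv {e : ETerm S} {n : ℕ} : Var.base n ∈ e.toTerm.fv ↔ n ∈ e.vars := by
  rw [fv_toTerm, baseVars, Finset.mem_image]
  exact ⟨fun ⟨m, hm, h⟩ => by cases h; exact hm, fun h => ⟨n, h, rfl⟩⟩

theorem toTerm_subst (x : Var) (f e : ETerm S) :
    e.toTerm.subst x f = (e.bind (single x f)).toTerm := by
  induction e with
  | var n =>
    simp only [toTerm_var, Term.subst, bind, single]
    split <;> rfl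
  | const c => rfl
  | add a b iha ihb => simp [Term.subst, bind, iha, ihb]
  | mul a b iha ihb => simp [Term.subst, bind, iha, ihb]
  | app h args ih => simp [Term.subst, bind, ih, toTerm_app]

theorem freeFor_toTerm (x : Var) (e : ETerm S) : e.toTerm.FreeFor x := by
  induction e <;> simp_all [Term.FreeFor, toTerm_app]

theorem bind_congr {σ τ : ℕ → ETerm S} {e : ETerm S} (h : ∀ n ∈ e.vars, σ n = τ n) :
    e.bind σ = e.bind τ := by
  induction e with
  | var n => exact h n (by simp [vars])
  | const c => rfl
  | add a b iha ihb =>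
    simp only [vars, Finset.mem_union] at h
    rw [bind, iha fun n hn => h n (.inl hn), ihb fun n hn => h n (.inr hn), bind]
  | mul a b iha ihb =>
    simp only [vars, Finset.mem_union] at h
    rw [bind, iha fun n hn => h n (.inl hn), ihb fun n hn => h n (.inr hn), bind]
  | app f args ih =>
    simp only [vars, Finset.mem_biUnion] at h
    simp only [bind]
    congr 1
    funext i
    exact ih i fun n hn => h n ⟨i, Finset.mem_univ i, hn⟩

theorem bind_var (e : ETerm S) : e.bind var = e := by
  induction e <;> simp_all [bind]

theorem bind_single_of_not_mem {x : Var} {f e : ETerm S} (h : x ∉ baseVars e.vars) :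
    e.bind (single x f) = e := by
  rw [bind_congr (τ := var), bind_var]
  intro n hn
  rw [single, if_neg]
  rintro rfl
  exact h (Finset.mem_image_of_mem _ hn)

theorem toTerm_bind (σ : ℕ → ETerm S) (e : ETerm S) :
    (e.bind σ).toTerm = e.inst (fun n => (σ n).toTerm) := by
  induction e <;> simp_all [bind, inst, toTerm_app]

theorem vars_bind_subset {σ : ℕ → ETerm S} {e : ETerm S} {V : Finset ℕ}
    (h : ∀ n ∈ e.vars, (σ n).vars ⊆ V) : (e.bind σ).vars ⊆ V := by
  induction e with
  | var n => exact h n (by simp [vars])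
  | const c => simp [bind, vars]
  | add a b iha ihb =>
    simp only [vars, Finset.mem_union] at h
    exact Finset.union_subset (iha fun n hn => h n (.inl hn)) (ihb fun n hn => h n (.inr hn))
  | mul a b iha ihb =>
    simp only [vars, Finset.mem_union] at h
    exact Finset.union_subset (iha fun n hn => h n (.inl hn)) (ihb fun n hn => h n (.inr hn))
  | app f args ih =>
    simp only [vars, Finset.mem_biUnion] at h
    simp only [bind, vars, Finset.biUnion_subset]
    exact fun i hi => ih i fun n hn => h n ⟨i, hi, hn⟩

/-- The abstract value of an extended term. -/
def val (v : Term S → ℝ) (e : ETerm S) : ℝ := e.toTerm.aeval v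

@[simp] theorem aeval_toTerm (v : Term S → ℝ) (e : ETerm S) : e.toTerm.aeval v = e.val v := rfl
@[simp] theorem val_const (v : Term S → ℝ) (c : ℚ) : (const c : ETerm S).val v = c := rfl
@[simp] theorem val_add (v : Term S → ℝ) (a b : ETerm S) : (add a b).val v = a.val v + b.val v :=
  rfl
@[simp] theorem val_mul (v : Term S → ℝ) (a b : ETerm S) : (mul a b).val v = a.val v * b.val v :=
  rfl
@[simp] theorem val_var (v : Term S → ℝ) (n : ℕ) :
    (var n : ETerm S).val v = v (.var (Var.base n)) := rfl

/-- The sum of finitely many extended terms. -/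
def sum (l : List (ETerm S)) : ETerm S := l.foldr add (const 0)

theorem vars_sum_subset {l : List (ETerm S)} {V : Finset ℕ} (h : ∀ e ∈ l, e.vars ⊆ V) :
    (sum l).vars ⊆ V := by
  induction l with
  | nil => simp [sum, vars]
  | cons a l ih =>
    exact Finset.union_subset (h a (by simp)) (ih fun e he => h e (by simp [he]))

theorem _root_.DL.Term.aeval_sum (v : Term S → ℝ) (l : List (Term S)) :
    (Term.sum l).aeval v = (l.map (Term.aeval v)).sum := by
  induction l with
  | nil => simp [Term.sum, Term.aeval]
  | cons a l ih => simp only [Term.sum, List.foldr_cons, Term.aeval] at *; simp [ih]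

theorem val_sum (v : Term S → ℝ) (l : List (ETerm S)) : (sum l).val v = (l.map (val v)).sum := by
  induction l with
  | nil => simp [sum]
  | cons a l ih => simp only [sum, List.foldr_cons, val_add] at *; simp [ih]

/-- The Lie derivative of an extended term along the vector field `σ`. -/
def lie {L : TermLanguage} (σ : ℕ → L.ET) : L.ET → L.ET
  | .var n => σ n
  | .const _ => .const 0
  | .add a b => .add (lie σ a) (lie σ b)
  | .mul a b => .add (.mul (lie σ a) b) (.mul a (lie σ b))
  | .app h args => sum (List.ofFn fun i =>
      .mul ((L.pd h i).bind fun n => if hn : n < L.arity h then args ⟨n, hn⟩ else .const 0)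
        (lie σ (args i)))

/-! ### Lie derivatives and syntactic differentials. -/

section lie

variable {L : TermLanguage} (σ : ℕ → L.ET)

@[simp] theorem lie_var (n : ℕ) : lie σ (var n) = σ n := rfl
@[simp] theorem lie_const (c : ℚ) : lie σ (const c) = const 0 := rfl
@[simp] theorem lie_add (a b : L.ET) : lie σ (add a b) = add (lie σ a) (lie σ b) := rfl
@[simp] theorem lie_mul (a b : L.ET) :
    lie σ (mul a b) = add (mul (lie σ a) b) (mul a (lie σ b)) := rfl

variable {σ}

theorem lie_congr {τ : ℕ → L.ET} {e : L.ET} (h : ∀ n ∈ e.vars, σ n = τ n) :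
    lie σ e = lie τ e := by
  induction e with
  | var n => exact h n (by simp [vars])
  | const c => rfl
  | add a b iha ihb =>
    simp only [vars, Finset.mem_union] at h
    rw [lie, iha fun n hn => h n (.inl hn), ihb fun n hn => h n (.inr hn), lie]
  | mul a b iha ihb =>
    simp only [vars, Finset.mem_union] at h
    rw [lie, iha fun n hn => h n (.inl hn), ihb fun n hn => h n (.inr hn), lie]
  | app f args ih =>
    simp only [vars, Finset.mem_biUnion] at h
    simp only [lie]
    congr 2
    funext i
    rw [ih i fun n hn => h n ⟨i, Finset.mem_univ i, hn⟩]

theorem vars_lie_subset {e : L.ET} {V : Finset ℕ} (he : e.vars ⊆ V)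
    (h : ∀ n ∈ V, (σ n).vars ⊆ V) : (lie σ e).vars ⊆ V := by
  induction e with
  | var n => exact h n (he (by simp [vars]))
  | const c => simp [vars]
  | add a b iha ihb =>
    rw [vars, Finset.union_subset_iff] at he
    exact Finset.union_subset (iha he.1) (ihb he.2)
  | mul a b iha ihb =>
    rw [vars, Finset.union_subset_iff] at he
    exact Finset.union_subset (Finset.union_subset (iha he.1) he.2)
      (Finset.union_subset he.1 (ihb he.2))
  | app f args ih =>
    simp only [vars, Finset.biUnion_subset] at he
    refine vars_sum_subset fun t ht => ?_
    obtain ⟨i, rfl⟩ := (List.mem_ofFn' _ _).1 ht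
    refine Finset.union_subset (vars_bind_subset fun n hn => ?_) (ih i (he i (Finset.mem_univ i)))
    rw [dif_pos (L.pd_vars f i n hn)]
    exact he _ (Finset.mem_univ _)

/-- If differential variables have the values given by the vector field, then differentials are
Lie derivatives. -/
theorem diff_eq_lie {Γ : List (Formula L.toSignature)} (e : L.ET)
    (h : ∀ n ∈ e.vars, Provable L Γ (.eq (.var (Var.base n).prime) (σ n).toTerm)) :
    Provable L Γ (.eq (.diff e.toTerm) (lie σ e).toTerm) := by
  induction e with
  | var n =>
    exact Provable.arith_two (.ax (.diff_var (Var.base n))) (h n (by simp [vars]))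
      trivial trivial trivial fun v h₁ h₂ => h₁.trans h₂
  | const c => exact .ax (.diff_const c)
  | add a b iha ihb =>
    simp only [vars, Finset.mem_union] at h
    refine Provable.arith_three (.ax (.diff_add a.toTerm b.toTerm)) (iha fun n hn => h n (.inl hn))
      (ihb fun n hn => h n (.inr hn)) trivial trivial trivial trivial fun v h₁ h₂ h₃ => ?_
    simp only [Formula.aholds_eq, aeval_toTerm, Term.aeval, lie_add, toTerm_add] at *
    rw [h₁, h₂, h₃]
  | mul a b iha ihb =>
    simp only [vars, Finset.mem_union] at h
    refine Provable.arith_three (.ax (.diff_mul a.toTerm b.toTerm)) (iha fun n hn => h n (.inl hn))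
      (ihb fun n hn => h n (.inr hn)) trivial trivial trivial trivial fun v h₁ h₂ h₃ => ?_
    simp only [Formula.aholds_eq, aeval_toTerm, Term.aeval, val_add, val_mul, lie_mul,
      toTerm_mul] at *
    rw [h₁, h₂, h₃]
  | app f args ih =>
    simp only [vars, Finset.mem_biUnion] at h
    have ih := fun i => ih i fun n hn => h n ⟨i, Finset.mem_univ i, hn⟩
    refine Provable.arith
      (.eq (.diff (app f args).toTerm) (Term.sum (List.ofFn fun i =>
        .mul ((L.pd f i).inst fun n => if hn : n < L.arity f then (args ⟨n, hn⟩).toTerm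
          else .const 0) (.diff (args i).toTerm))) ::
        List.ofFn fun i => .eq (.diff (args i).toTerm) (lie σ (args i)).toTerm)
      ?_ ?_ trivial fun v hv => ?_
    · simp only [List.mem_cons, forall_eq_or_imp, List.mem_ofFn]
      refine ⟨.ax (.diff_app f fun i => (args i).toTerm), ?_⟩
      rintro _ ⟨i, rfl⟩
      exact ih i
    · simp only [List.mem_cons, forall_eq_or_imp, List.mem_ofFn]
      refine ⟨trivial, ?_⟩
      rintro _ ⟨i, rfl⟩
      trivial
    · simp only [List.mem_cons, forall_eq_or_imp, List.mem_ofFn, forall_exists_index,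
        forall_apply_eq_imp_iff, Formula.aholds_eq, aeval_toTerm] at hv
      rw [Formula.aholds_eq, hv.1, Term.aeval_sum, lie, aeval_toTerm, val_sum,
        List.map_ofFn, List.map_ofFn]
      congr 2
      funext i
      simp only [Function.comp, Term.aeval, val_mul]
      rw [← hv.2 i, val, toTerm_bind]
      congr 4
      funext n
      split <;> rfl

end lie

end ETerm

/-! ### The vector field of a differential equation -/

/-- The right-hand side for a variable; it is `0` for variables that do not evolve. -/
def rhsOf : List (ℕ × ETerm S) → ℕ → ETerm S
  | [], _ => .const 0
  | p :: l, n => if p.1 = n then p.2 else rhsOf l n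

theorem rhsOf_of_not_mem {l : List (ℕ × ETerm S)} {n : ℕ} (h : n ∉ l.map Prod.fst) :
    rhsOf l n = .const 0 := by
  induction l with
  | nil => rfl
  | cons p l ih =>
    simp only [List.map_cons, List.mem_cons, not_or] at h
    rw [rhsOf, if_neg (Ne.symm h.1), ih h.2]

theorem rhsOf_of_mem {l : List (ℕ × ETerm S)} (hl : (l.map Prod.fst).Nodup) {p : ℕ × ETerm S}
    (hp : p ∈ l) : rhsOf l p.1 = p.2 := by
  induction l with
  | nil => simp at hp
  | cons q l ih =>
    rw [List.map_cons, List.nodup_cons] at hl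
    rcases List.mem_cons.1 hp with rfl | hp
    · rw [rhsOf, if_pos rfl]
    · rw [rhsOf, if_neg, ih hl.2 hp]
      intro h
      exact hl.1 (h ▸ List.mem_map_of_mem hp)

theorem rhsOf_append_of_ne {l : List (ℕ × ETerm S)} {p : ℕ × ETerm S} {n : ℕ} (h : n ≠ p.1) :
    rhsOf (l ++ [p]) n = rhsOf l n := by
  induction l with
  | nil => simp [rhsOf, h.symm]
  | cons q l ih => simp only [List.cons_append, rhsOf, ih]

namespace ODE

def rhs (o : ODE S) : ℕ → ETerm S := rhsOf o.sys

theorem rhs_of_mem {o : ODE S} {p : ℕ × ETerm S} (hp : p ∈ o.sys) : o.rhs p.1 = p.2 :=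
  rhsOf_of_mem o.nodup hp

theorem rhs_of_not_mem {o : ODE S} {n : ℕ} (h : n ∉ o.lhs) : o.rhs n = .const 0 :=
  rhsOf_of_not_mem h

theorem vars_rhs_subset (o : ODE S) (n : ℕ) : (o.rhs n).vars ⊆ o.vars := by
  refine Finset.Subset.trans ?_ Finset.subset_union_right
  unfold rhs
  induction o.sys with
  | nil => simp [rhsOf, ETerm.vars]
  | cons p l ih =>
    rw [rhsOf, List.foldr_cons]
    split
    · exact Finset.subset_union_left
    · exact ih.trans Finset.subset_union_right

theorem mem_vars_of_mem_lhs {o : ODE S} {n : ℕ} (h : n ∈ o.lhs) : n ∈ o.vars :=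
  Finset.mem_union_left _ (List.mem_toFinset.2 h)

/-- Add an equation for a new variable. -/
def extend (o : ODE S) (y : ℕ) (r : ETerm S) (hy : y ∉ o.vars) : ODE S where
  sys := o.sys ++ [(y, r)]
  nodup := by
    rw [List.map_append, List.nodup_append]
    refine ⟨o.nodup, by simp, ?_⟩
    rintro a ha b hb rfl
    simp only [List.map_cons, List.map_nil, List.mem_singleton] at hb
    exact hy (hb ▸ mem_vars_of_mem_lhs ha)

variable {o : ODE S} {y : ℕ} {r : ETerm S} {hy : y ∉ o.vars}

@[simp] theorem sys_extend : (o.extend y r hy).sys = o.sys ++ [(y, r)] := rfl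

theorem rhs_extend_self : (o.extend y r hy).rhs y = r :=
  rhs_of_mem (o := o.extend y r hy) (p := (y, r)) (by simp [extend])

theorem rhs_extend_of_ne {n : ℕ} (h : n ≠ y) : (o.extend y r hy).rhs n = o.rhs n :=
  rhsOf_append_of_ne h

end ODE

/-- Only ordinary variables are free. -/
def Formula.IsBase (φ : Formula S) : Prop := ∀ x ∈ φ.fv, x.ord = 0

theorem Formula.IsBase.prime_notMem {φ : Formula S} (h : φ.IsBase) (n : ℕ) :
    (Var.base n).prime ∉ φ.fv := fun hn => by simpa [Var.prime] using h _ hn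

theorem SFml.fv_toFormula (P : SFml S) : P.toFormula.fv = baseVars P.vars := by
  induction P <;>
    simp_all [toFormula, Formula.fv, vars, baseVars, Finset.image_union, ETerm.fv_toTerm]

theorem baseVars_ord {s : Finset ℕ} {x : Var} (h : x ∈ baseVars s) : x.ord = 0 := by
  obtain ⟨n, -, rfl⟩ := Finset.mem_image.1 h
  rfl

theorem base_mem_baseVars {s : Finset ℕ} {n : ℕ} : Var.base n ∈ baseVars s ↔ n ∈ s := by
  rw [baseVars, Finset.mem_image]
  exact ⟨fun ⟨m, hm, h⟩ => by cases h; exact hm, fun h => ⟨n, h, rfl⟩⟩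

theorem SFml.isBase_toFormula (P : SFml S) : P.toFormula.IsBase := fun x hx => by
  rw [fv_toFormula] at hx
  exact baseVars_ord hx

theorem SFml.qf_toFormula (P : SFml S) : P.toFormula.QF := by
  induction P <;> simp_all [toFormula, Formula.QF]

theorem Formula.isBase_box_ode (o : ODE S) (Q : SFml S) {φ : Formula S} (h : φ.IsBase) :
    (Formula.box (.ode o Q) φ).IsBase := by
  intro x hx
  rcases Finset.mem_union.1 hx with hx | hx
  · exact baseVars_ord hx
  · exact h x (Finset.mem_sdiff.1 hx).1

theorem Formula.isBase_cmp (c : Cmp) (a b : ETerm S) :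
    (Formula.cmp c a.toTerm b.toTerm).IsBase := by
  intro x hx
  rcases Finset.mem_union.1 hx with hx | hx <;> exact ETerm.ord_of_mem_fv hx

/-! ### Differential effect and differential invariants. -/

namespace Provable

open Formula

variable {L : TermLanguage} {Γ Δ : List (Formula L.toSignature)} {φ ψ χ : Formula L.toSignature}

theorem box_of_disjoint {α : Program L.toSignature} (h : Provable L Γ φ)
    (hφ : Disjoint φ.fv α.bv) : Provable L Γ (.box α φ) :=
  mp (.ax (.V α φ hφ)) h

/-- After assigning right-hand sides to differential variables, the corresponding equations may be
used. -/
theorem assign_diffs (l : List (ℕ × L.ET)) (hl : (l.map Prod.fst).Nodup)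
    (hΓ : ∀ χ ∈ Γ, ∀ p ∈ l, (Var.base p.1).prime ∉ χ.fv)
    (h : Provable L (l.map (fun p => eq (.var (Var.base p.1).prime) p.2.toTerm) ++ Γ) φ) :
    Provable L Γ (l.foldr (fun p ψ => .box (.assign (Var.base p.1).prime p.2) ψ) φ) := by
  induction l generalizing Γ with
  | nil => exact h
  | cons p l ih =>
    rw [List.map_cons, List.nodup_cons] at hl
    rw [List.foldr_cons]
    -- The assignment establishes its own equation because its right-hand side contains no
    -- differential variable. The formulas of `Γ` survive it by axiom `V`.
    refine box_mono _ (eq (.var (Var.base p.1).prime) p.2.toTerm :: Γ) ?_ (ih hl.2 ?_ ?_)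
    · simp only [List.mem_cons, forall_eq_or_imp]
      constructor
      · refine iff_mpr (.ax (.assign _ _ _ ⟨trivial, ETerm.freeFor_toTerm _ _⟩)) ?_
        refine of_valid trivial fun v => ?_
        simp only [Formula.eq, Formula.subst, ETerm.toTerm_subst, Term.subst, if_pos]
        rw [ETerm.bind_single_of_not_mem]
        · exact (rfl : _ = _)
        · intro h
          simpa [Var.prime] using baseVars_ord h
      · intro χ hχ
        refine box_of_disjoint (.hyp hχ) ?_
        simpa [Program.bv] using hΓ χ hχ p (by simp)
    · simp only [List.mem_cons, forall_eq_or_imp]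
      refine ⟨fun q hq hmem => ?_, fun χ hχ q hq => hΓ χ hχ q (by simp [hq])⟩
      rcases Finset.mem_union.1 hmem with hmem | hmem
      · simp only [Term.fv, Finset.mem_singleton, Var.prime, Var.base, Var.mk.injEq,
          and_true] at hmem
        exact hl.1 (hmem ▸ List.mem_map_of_mem hq)
      · simpa [Var.prime] using ETerm.ord_of_mem_fv hmem
    · refine .weaken ?_ h
      intro χ
      simp only [List.map_cons, List.cons_append, List.mem_cons, List.mem_append]
      tauto

/-- Along a differential equation, differentials are Lie derivatives. -/
theorem box_diff_eq_lie (o : ODE L.toSignature) (Q : SFml L.toSignature) (e : L.ET)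
    (hz : ∀ n ∈ e.vars, n ∉ o.lhs → Provable L Γ (eq (.var (Var.base n).prime) (.const 0))) :
    Provable L Γ (.box (.ode o Q) (eq (.diff e.toTerm) (e.lie o.rhs).toTerm)) := by
  -- `DE` provides the differentials of evolving variables. For the other variables of `e`, the
  -- hypotheses `x' = 0` pass the differential equation unchanged, since it does not bind these
  -- `x'`.
  refine iff_mpr (.ax (.DE o Q _)) (box_mono _
    ((e.vars.toList.filter (· ∉ o.lhs)).map fun n => eq (.var (Var.base n).prime) (.const 0))
    ?_ (assign_diffs _ o.nodup ?_ ?_))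
  · simp only [List.mem_map, List.mem_filter, Finset.mem_toList, decide_eq_true_eq]
    rintro _ ⟨n, ⟨hn, hno⟩, rfl⟩
    refine box_of_disjoint (hz n hn hno) ?_
    simp only [Formula.eq, Formula.fv, Term.fv, Finset.union_empty, Finset.disjoint_singleton_left]
    intro h
    rcases Finset.mem_union.1 h with h | h
    · simpa [Var.prime] using baseVars_ord h
    · obtain ⟨x, hx, h⟩ := Finset.mem_image.1 h
      obtain ⟨m, hm, rfl⟩ := Finset.mem_image.1 hx
      simp only [Var.prime, Var.base, Var.mk.injEq, and_true] at h
      exact hno (h ▸ List.mem_toFinset.1 hm)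
  · simp only [List.mem_map, List.mem_filter, Finset.mem_toList, decide_eq_true_eq]
    rintro _ ⟨n, ⟨hn, hno⟩, rfl⟩ p hp
    simp only [Formula.eq, Formula.fv, Term.fv, Finset.union_empty, Finset.mem_singleton]
    intro h
    simp only [Var.prime, Var.base, Var.mk.injEq, and_true] at h
    exact hno (h ▸ List.mem_map_of_mem hp)
  · refine ETerm.diff_eq_lie e fun n hn => .hyp ?_
    by_cases hno : n ∈ o.lhs
    · obtain ⟨p, hp, rfl⟩ := List.mem_map.1 hno
      refine List.mem_append_left _ (List.mem_map.2 ⟨p, hp, ?_⟩)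
      rw [ODE.rhs_of_mem hp]
    · refine List.mem_append_right _ (List.mem_map.2 ⟨n, ?_, ?_⟩)
      · simp [hn, hno]
      · rw [ODE.rhs_of_not_mem hno, ETerm.toTerm_const]

/-- Differential variables of variables that occur nowhere else may be assumed to vanish. -/
theorem assume_primes (W : List ℕ) (hW : W.Nodup) (hΓ : ∀ χ ∈ Γ, χ.IsBase) (hφ : φ.IsBase)
    (h : Provable L (W.map (fun n => eq (.var (Var.base n).prime) (.const 0)) ++ Γ) φ) :
    Provable L Γ φ := by
  induction W with
  | nil => exact h
  | cons n W ih =>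
    rw [List.nodup_cons] at hW
    refine ih hW.2 (fresh (Var.base n).prime (.const 0) (by simp [Term.fv]) ?_
      (hφ.prime_notMem n) h)
    intro χ hχ
    rcases List.mem_append.1 hχ with hχ | hχ
    · obtain ⟨m, hm, rfl⟩ := List.mem_map.1 hχ
      simp only [Formula.eq, Formula.fv, Term.fv, Finset.union_empty, Finset.mem_singleton,
        Var.prime, Var.base, Var.mk.injEq, and_true]
      rintro rfl
      exact hW.1 hm
    · exact (hΓ χ hχ).prime_notMem n

variable {o : ODE L.toSignature} {Q : SFml L.toSignature} {e : L.ET}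

theorem di_ge
    (hz : ∀ n ∈ e.vars, n ∉ o.lhs → Provable L Γ (eq (.var (Var.base n).prime) (.const 0)))
    (h₀ : Provable L Γ (.cmp .ge e.toTerm (.const 0)))
    (h : Provable L Γ (.box (.ode o Q) (.cmp .ge (e.lie o.rhs).toTerm (.const 0)))) :
    Provable L Γ (.box (.ode o Q) (.cmp .ge e.toTerm (.const 0))) := by
  refine iff_mpr (mp (.DI_cmp .ge (.inl rfl) o Q e hz) ?_) (.impR h₀.cons)
  refine box_two h (box_diff_eq_lie o Q e hz) (arith_two head head.cons trivial trivial trivial ?_)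
  intro v h₁ h₂
  exact le_trans h₁ (ge_of_eq h₂)

theorem di_eq
    (hz : ∀ n ∈ e.vars, n ∉ o.lhs → Provable L Γ (eq (.var (Var.base n).prime) (.const 0)))
    (h₀ : Provable L Γ (eq e.toTerm (.const 0)))
    (h : Provable L Γ (.box (.ode o Q) (eq (e.lie o.rhs).toTerm (.const 0)))) :
    Provable L Γ (.box (.ode o Q) (eq e.toTerm (.const 0))) := by
  refine iff_mpr (mp (.DI_eq o Q e hz) ?_) (.impR h₀.cons)
  refine box_two h (box_diff_eq_lie o Q e hz) (arith_two head head.cons trivial trivial trivial ?_)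
  intro v h₁ h₂
  exact h₂.trans h₁

end Provable

/-! ### Sums of squares and orbits -/

/-- The sum of the squares of extended terms. -/
def ETerm.sumSq (l : List (ETerm S)) : ETerm S := ETerm.sum (l.map fun e => .mul e e)

namespace ETerm

@[simp] theorem sumSq_nil : sumSq ([] : List (ETerm S)) = const 0 := rfl
@[simp] theorem sumSq_cons (e : ETerm S) (l : List (ETerm S)) :
    sumSq (e :: l) = add (mul e e) (sumSq l) := rfl

theorem val_sumSq_nonneg (v : Term S → ℝ) (l : List (ETerm S)) : 0 ≤ (sumSq l).val v := by
  induction l with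
  | nil => simp
  | cons e l ih => simp only [sumSq_cons, val_add, val_mul]; nlinarith [sq_nonneg (e.val v)]

theorem sq_le_val_sumSq (v : Term S → ℝ) {l : List (ETerm S)} {e : ETerm S} (he : e ∈ l) :
    e.val v * e.val v ≤ (sumSq l).val v := by
  induction l with
  | nil => simp at he
  | cons a l ih =>
    simp only [sumSq_cons, val_add, val_mul]
    rcases List.mem_cons.1 he with rfl | he
    · linarith [val_sumSq_nonneg v l]
    · nlinarith [ih he, mul_self_nonneg (a.val v)]

theorem val_sumSq_eq_zero (v : Term S → ℝ) {l : List (ETerm S)} :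
    (sumSq l).val v = 0 ↔ ∀ e ∈ l, e.val v = 0 := by
  constructor
  · intro h e he
    have := sq_le_val_sumSq v he
    exact mul_self_eq_zero.1 (le_antisymm (h ▸ this) (mul_self_nonneg _))
  · intro h
    induction l with
    | nil => simp
    | cons e l ih =>
      simp only [sumSq_cons, val_add, val_mul, h e (by simp), ih fun a ha => h a (by simp [ha])]
      simp

theorem vars_sumSq_subset {l : List (ETerm S)} {V : Finset ℕ} (h : ∀ e ∈ l, e.vars ⊆ V) :
    (sumSq l).vars ⊆ V := by
  refine vars_sum_subset fun e he => ?_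
  obtain ⟨a, ha, rfl⟩ := List.mem_map.1 he
  exact Finset.union_subset (h a ha) (h a ha)

/-- An upper bound for the squared norm of the cofactors. -/
def cofactorBound : List (ETerm S) → ETerm S
  | [] => .const 0
  | g :: gs => .mul (.const 2) (.add (.mul g g) (cofactorBound gs))

theorem val_cofactorBound_nonneg (v : Term S → ℝ) (gs : List (ETerm S)) :
    0 ≤ (cofactorBound gs).val v := by
  induction gs with
  | nil => simp [cofactorBound]
  | cons g gs ih =>
    simp only [cofactorBound, val_add, val_mul, val_const]
    push_cast
    nlinarith [mul_self_nonneg (g.val v)]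

/-- A weak Cauchy–Schwarz inequality. The factor `2` at each stage of `cofactorBound` comes from `(a
+ b)² ≤ 2a² + 2b²`, which is enough here and makes the induction direct. -/
theorem sq_val_combination_le (v : Term S → ℝ) (gs es : List (ETerm S)) :
    (combination gs es).val v ^ 2 ≤ (cofactorBound gs).val v * (sumSq es).val v := by
  induction gs generalizing es with
  | nil => simp [combination, cofactorBound]
  | cons g gs ih =>
    cases es with
    | nil => simp [combination]
    | cons e es =>
      have h₁ := ih es
      have h₂ := val_cofactorBound_nonneg v gs
      have h₃ := val_sumSq_nonneg v es
      have : combination (g :: gs) (e :: es) = add (mul g e) (combination gs es) := rfl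
      rw [this]
      simp only [cofactorBound, sumSq_cons, val_add, val_mul, val_const]
      push_cast
      nlinarith [sq_nonneg (g.val v * e.val v - (combination gs es).val v),
        mul_nonneg (mul_self_nonneg (g.val v)) h₃, mul_nonneg h₂ (mul_self_nonneg (e.val v))]

end ETerm

/-- The list of the first `n + 1` iterates, the latest one first. -/
def orbit {α : Type*} (F : α → α) (a : α) : ℕ → List α
  | 0 => [a]
  | n + 1 => F^[n + 1] a :: orbit F a n

theorem mem_orbit {α : Type*} {F : α → α} {a x : α} {n : ℕ} :
    x ∈ orbit F a n ↔ ∃ i ≤ n, x = F^[i] a := by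
  induction n with
  | zero => simp [orbit]
  | succ n ih =>
    rw [orbit, List.mem_cons, ih]
    constructor
    · rintro (rfl | ⟨i, hi, rfl⟩)
      · exact ⟨_, le_rfl, rfl⟩
      · exact ⟨i, by omega, rfl⟩
    · rintro ⟨i, hi, rfl⟩
      rcases Nat.lt_or_ge n i with h | h
      · exact .inl (by rw [show i = n + 1 by omega])
      · exact .inr ⟨i, h, rfl⟩

theorem orbit_eq_cons {α : Type*} (F : α → α) (a : α) (n : ℕ) :
    ∃ l, orbit F a n = F^[n] a :: l := by
  cases n with
  | zero => exact ⟨[], rfl⟩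
  | succ n => exact ⟨_, rfl⟩

namespace ETerm

variable {L : TermLanguage}

/-- The derivative is the sum of the `2 pᵢ pᵢ₊₁`, and `2 pᵢ pᵢ₊₁ ≤ pᵢ² + pᵢ₊₁²`. Only the last
square leaves the orbit; the ideal identity will bound it. -/
theorem val_lie_sumSq_orbit_le (v : Term L.toSignature → ℝ) (σ : ℕ → L.ET) (p : L.ET) (n : ℕ) :
    (lie σ (sumSq (orbit (lie σ) p n))).val v ≤
      ((lie σ)^[n + 1] p).val v ^ 2 + 2 * (sumSq (orbit (lie σ) p n)).val v := by
  induction n with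
  | zero =>
    simp only [orbit, sumSq_cons, sumSq_nil, lie_add, lie_mul, val_add, val_mul, lie_const,
      val_const, zero_add, Function.iterate_one]
    push_cast
    nlinarith [sq_nonneg (p.val v - (lie σ p).val v), sq_nonneg (p.val v)]
  | succ n ih =>
    rw [orbit, sumSq_cons]
    simp only [lie_add, lie_mul, val_add, val_mul]
    rw [← Function.iterate_succ_apply' (lie σ)]
    nlinarith [sq_nonneg (((lie σ)^[n + 1] p).val v - ((lie σ)^[n + 1 + 1] p).val v)]

theorem vars_iterate_lie_subset {σ : ℕ → L.ET} {p : L.ET} {V : Finset ℕ} (hp : p.vars ⊆ V)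
    (h : ∀ n ∈ V, (σ n).vars ⊆ V) (i : ℕ) : ((lie σ)^[i] p).vars ⊆ V := by
  induction i with
  | zero => exact hp
  | succ i ih => rw [Function.iterate_succ_apply']; exact vars_lie_subset ih h

end ETerm

/-! ### Sufficiency for differential equations: a Grönwall argument with differential ghosts. -/

namespace Provable

open Formula

variable {L : TermLanguage} {Γ : List (Formula L.toSignature)}

/-- An initially vanishing term stays zero if its higher Lie derivatives vanish initially and lie
in a finitely generated differential ideal. -/
theorem box_eq_zero_of_orbit (o : ODE L.toSignature) (Q : SFml L.toSignature) (p : L.ET) (n : ℕ)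
    (gs : List L.ET)
    (hgs : Provable L [] (eq ((ETerm.lie o.rhs)^[n + 1] p).toTerm
      (combination gs (orbit (ETerm.lie o.rhs) p n)).toTerm)) :
    Provable L [eq (ETerm.sumSq (orbit (ETerm.lie o.rhs) p n)).toTerm (.const 0)]
      (.box (.ode o Q) (eq p.toTerm (.const 0))) := by
  set w := ETerm.sumSq (orbit (ETerm.lie o.rhs) p n) with hw
  -- The growth rate: `w' ≤ pₙ₊₁² + 2w ≤ g w`.
  obtain ⟨g, hg⟩ : ∃ g : L.ET, g = .add (.const 2) (ETerm.cofactorBound gs) := ⟨_, rfl⟩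
  obtain ⟨y, hy⟩ := Infinite.exists_notMem_finset (o.vars ∪ Q.vars ∪ p.vars ∪ w.vars ∪ g.vars)
  simp only [Finset.mem_union, not_or] at hy
  obtain ⟨⟨⟨⟨hyo, hyQ⟩, hyp⟩, hyw⟩, hyg⟩ := hy
  -- The ghost `y' = -g y` compensates the growth: `w y²` does not increase. The second ghost below,
  -- `z' = g z`, keeps `y z = 1` and thereby certifies that `y` never vanishes.
  obtain ⟨o₁, ho₁⟩ : ∃ o₁, o₁ = o.extend y (.mul (.mul (.const (-1)) g) (.var y)) hyo := ⟨_, rfl⟩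
  obtain ⟨z, hz⟩ := Infinite.exists_notMem_finset
    (o₁.vars ∪ Q.vars ∪ p.vars ∪ w.vars ∪ g.vars ∪ {y})
  simp only [Finset.mem_union, not_or, Finset.mem_singleton] at hz
  obtain ⟨⟨⟨⟨⟨hzo, hzQ⟩, hzp⟩, hzw⟩, hzg⟩, hzy⟩ := hz
  obtain ⟨o₂, ho₂⟩ : ∃ o₂, o₂ = o₁.extend z (.mul g (.var z)) hzo := ⟨_, rfl⟩
  have hbase (m : ℕ) (e : L.ET) (hm : m ∉ e.vars) :
      Var.base m ∉ (eq e.toTerm (.const 0)).fv := by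
    simpa [Formula.eq, Formula.fv, Term.fv, ETerm.base_mem_fv] using hm
  have hprime (m : ℕ) (e : L.ET) : (Var.base m).prime ∉ (eq e.toTerm (.const 0)).fv :=
    (isBase_cmp .eq e (.const 0)).prime_notMem m
  have hσy : o₂.rhs y = .mul (.mul (.const (-1)) g) (.var y) := by
    rw [ho₂, ODE.rhs_extend_of_ne (Ne.symm hzy), ho₁, ODE.rhs_extend_self]
  have hσz : o₂.rhs z = .mul g (.var z) := by rw [ho₂, ODE.rhs_extend_self]
  have hσw : ETerm.lie o₂.rhs w = ETerm.lie o.rhs w := by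
    refine ETerm.lie_congr fun m hm => ?_
    rw [ho₂, ODE.rhs_extend_of_ne, ho₁, ODE.rhs_extend_of_ne]
    · rintro rfl; exact hyw hm
    · rintro rfl; exact hzw hm
  refine iff_mpr (.ax (.DG_ex o o₁ Q _ y (r := .mul (.mul (.const (-1)) g) (.var y))
    ⟨.mul (.const (-1)) g, .const 0, ?_, ?_, .inr (.inl rfl)⟩ (by rw [ho₁]; rfl) ?_
    (hbase y p hyp) (hprime y p))) ?_
  · simpa [ETerm.vars] using hyg
  · simp [ETerm.vars]
  · simp [hyo, hyQ]
  -- Both ghosts start at `1`. Being fresh, each variable can be assumed to equal `1` and then serve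
  -- as its own existential witness.
  refine fresh (Var.base y) (.const 1) (by simp [Term.fv]) ?_ (by simp [Formula.fv]) (ex_self ?_)
  · simpa using hbase y w hyw
  refine iff_mpr (.ax (.DG_ex o₁ o₂ Q _ z (r := .mul g (.var z))
    ⟨g, .const 0, hzg, ?_, .inr (.inl rfl)⟩ (by rw [ho₂]; rfl) ?_
    (hbase z p hzp) (hprime z p))) ?_
  · simp [ETerm.vars]
  · simp [hzo, hzQ]
  refine fresh (Var.base z) (.const 1) (by simp [Term.fv]) ?_ (by simp [Formula.fv]) (ex_self ?_)
  · simp only [List.mem_cons, forall_eq_or_imp, List.not_mem_nil, false_imp_iff, implies_true,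
      and_true]
    refine ⟨?_, hbase z w hzw⟩
    simp only [Formula.eq, Formula.fv, Term.fv, Finset.union_empty, Finset.mem_singleton,
      Var.base, Var.mk.injEq, and_true]
    exact hzy
  -- The invariants are `y z - 1 = 0` and `-w y² ≥ 0`.
  obtain ⟨e₁, he₁⟩ : ∃ e : L.ET, e = .add (.mul (.var y) (.var z)) (.const (-1)) := ⟨_, rfl⟩
  obtain ⟨e₂, he₂⟩ : ∃ e : L.ET, e = .mul (.const (-1)) (.mul w (.mul (.var y) (.var y))) :=
    ⟨_, rfl⟩
  -- `DI` requires vanishing differentials for the variables that do not evolve. The sequent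
  -- mentions no differential variable, so they may be assumed to be zero.
  refine assume_primes (e₁.vars ∪ e₂.vars).toList (Finset.nodup_toList _) ?_
    (isBase_box_ode _ _ (isBase_cmp .eq p (.const 0))) ?_
  · simp only [List.mem_cons, forall_eq_or_imp, List.not_mem_nil, false_imp_iff, implies_true,
      and_true]
    exact ⟨isBase_cmp .eq (.var z) (.const 1), isBase_cmp .eq (.var y) (.const 1),
      isBase_cmp .eq w (.const 0)⟩
  set Γ := (e₁.vars ∪ e₂.vars).toList.map (fun n => eq (.var (Var.base n).prime) (.const 0)) ++
    [eq (.var (Var.base z)) (.const 1), eq (.var (Var.base y)) (.const 1),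
      eq w.toTerm (.const 0)] with hΓ
  have hprimes (m : ℕ) (hm : m ∈ e₁.vars ∪ e₂.vars) :
      Provable L Γ (eq (.var (Var.base m).prime) (.const 0)) :=
    .hyp (List.mem_append_left _ (List.mem_map.2 ⟨m, Finset.mem_toList.2 hm, rfl⟩))
  have hz1 : Provable L Γ (eq (.var (Var.base z)) (.const 1)) := .hyp (by simp [hΓ])
  have hy1 : Provable L Γ (eq (.var (Var.base y)) (.const 1)) := .hyp (by simp [hΓ])
  have hw0 : Provable L Γ (eq w.toTerm (.const 0)) := .hyp (by simp [hΓ])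
  refine box_two (ψ := eq e₁.toTerm (.const 0)) (χ := .cmp .ge e₂.toTerm (.const 0)) ?_ ?_ ?_
  · refine di_eq (fun m hm _ => hprimes m (Finset.mem_union_left _ hm)) ?_ (.G _ ?_)
    · refine arith_two hz1 hy1 trivial trivial trivial fun v h₁ h₂ => ?_
      simp only [aholds_eq, Term.aeval, ETerm.aeval_toTerm, he₁, ETerm.val_add, ETerm.val_mul,
        ETerm.val_var, ETerm.val_const] at *
      rw [h₁, h₂]; norm_num
    · refine of_valid trivial fun v => ?_
      simp only [aholds_eq, Term.aeval, ETerm.aeval_toTerm, he₁, ETerm.lie_add, ETerm.lie_mul,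
        ETerm.lie_var, hσy, hσz, ETerm.val_add, ETerm.val_mul, ETerm.val_var, ETerm.val_const,
        ETerm.lie_const]
      push_cast; ring
  · refine di_ge (fun m hm _ => hprimes m (Finset.mem_union_right _ hm)) ?_ (.G _ ?_)
    · refine arith_one hw0 trivial trivial fun v h => ?_
      simp only [aholds_eq, Formula.aholds, Cmp.holds, Term.aeval, ETerm.aeval_toTerm, he₂,
        ETerm.val_mul, ETerm.val_const] at *
      rw [h]; simp
    · refine arith_one hgs trivial trivial fun v h => ?_
      have h₁ := ETerm.val_lie_sumSq_orbit_le v o.rhs p n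
      have h₂ := ETerm.sq_val_combination_le v gs (orbit (ETerm.lie o.rhs) p n)
      have h₃ := ETerm.val_cofactorBound_nonneg v gs
      have h₄ := ETerm.val_sumSq_nonneg v (orbit (ETerm.lie o.rhs) p n)
      simp only [aholds_eq, Formula.aholds, Cmp.holds, Term.aeval, ETerm.aeval_toTerm, he₂,
        ETerm.lie_mul, ETerm.lie_const, ETerm.lie_var, hσy, hσw, hg, ETerm.val_add,
        ETerm.val_mul, ETerm.val_const, ETerm.val_var] at *
      rw [← hw] at h₁ h₂ h₄
      rw [h] at h₁
      push_cast
      -- The derivative of `-w y²` is `(2 g w - w') y²`. The factor `2` comes from the square of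
      -- `y`, so this bound is weaker than `w' ≤ g w`.
      have h₅ : (ETerm.lie o.rhs w).val v ≤
          2 * ((2 + (ETerm.cofactorBound gs).val v) * w.val v) := by
        nlinarith [mul_nonneg h₃ h₄]
      nlinarith [mul_nonneg (sub_nonneg.2 h₅) (mul_self_nonneg (v (.var (Var.base y))))]
  -- From `y z = 1` follows `y ≠ 0`; then `-w y² ≥ 0` gives `w ≤ 0`, while `p² ≤ w`.
  · refine arith_two head head.cons trivial trivial trivial fun v h₁ h₂ => ?_
    have hp := ETerm.sq_le_val_sumSq v (mem_orbit.2 ⟨0, n.zero_le, rfl⟩ :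
      p ∈ orbit (ETerm.lie o.rhs) p n)
    simp only [aholds_eq, Formula.aholds, Cmp.holds, Term.aeval, ETerm.aeval_toTerm, he₁, he₂,
      ETerm.val_add, ETerm.val_mul, ETerm.val_const, ETerm.val_var] at *
    rw [← hw] at hp
    push_cast at *
    have hy0 : v (.var (Var.base y)) ≠ 0 := by
      intro h0
      rw [h0] at h₁
      norm_num at h₁
    have hy2 := mul_self_pos.2 hy0
    have : w.val v ≤ 0 := by
      by_contra hcon
      nlinarith [mul_pos (not_le.1 hcon) hy2]
    exact mul_self_eq_zero.1 (le_antisymm (hp.trans this) (mul_self_nonneg _))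

end Provable

/-! ### Local progress -/

theorem aholds_eqVec (v : Term S → ℝ) (l : List ℕ) (ρ : ℕ → ℕ) :
    ((eqVec l ρ : SFml S).toFormula).aholds v ↔
      ∀ n ∈ l, v (.var (Var.base n)) = v (.var (Var.base (ρ n))) := by
  induction l with
  | nil => simp [eqVec, SFml.tru, SFml.toFormula, Formula.aholds, Cmp.holds]
  | cons n l ih =>
    simp only [eqVec, List.foldr_cons, SFml.toFormula, Formula.aholds, List.mem_cons,
      forall_eq_or_imp] at *
    rw [ih]
    rfl

theorem vars_eqVec_subset (l : List ℕ) (ρ : ℕ → ℕ) :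
    (eqVec l ρ : SFml S).vars ⊆ l.toFinset ∪ l.toFinset.image ρ := by
  induction l with
  | nil => simp [eqVec, SFml.tru, SFml.vars, ETerm.vars]
  | cons n l ih =>
    intro m hm
    simp only [eqVec, List.foldr_cons, SFml.vars, ETerm.vars, Finset.mem_union,
      Finset.mem_singleton] at hm
    rcases hm with (rfl | rfl) | hm
    · simp
    · simp
    · have := ih hm
      simp only [Finset.mem_union, List.mem_toFinset, Finset.mem_image, List.mem_cons] at this ⊢
      rcases this with h | ⟨a, ha, rfl⟩
      · exact .inl (.inr h)
      · exact .inr ⟨a, .inr ha, rfl⟩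

theorem ODE.exists_freshCopy (o : ODE S) (V : Finset ℕ) : ∃ ρ, o.FreshCopy ρ V := by
  refine ⟨fun n => n + ((o.vars ∪ V).sup id + 1), ?_, fun n _ hn => ?_⟩
  · exact o.nodup.map fun a b h => by simpa using h
  · have : n + ((o.vars ∪ V).sup id + 1) ≤ (o.vars ∪ V).sup id := Finset.le_sup (f := id) hn
    omega

theorem ODE.FreshCopy.mono {o : ODE S} {ρ : ℕ → ℕ} {V W : Finset ℕ} (h : o.FreshCopy ρ W)
    (hV : V ⊆ W) : o.FreshCopy ρ V :=
  ⟨h.1, fun n hn hm => h.2 n hn (Finset.union_subset_union_right hV hm)⟩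

theorem baseVars_mono {V W : Finset ℕ} (h : V ⊆ W) : baseVars V ⊆ baseVars W :=
  Finset.image_subset_image h

theorem Formula.isBase_of_subset {φ : Formula S} {V : Finset ℕ} (h : φ.fv ⊆ baseVars V) :
    φ.IsBase := fun _ hx => baseVars_ord (h hx)

theorem Formula.fv_cmp_subset {c : Cmp} {a b : ETerm S} {V : Finset ℕ} (ha : a.vars ⊆ V)
    (hb : b.vars ⊆ V) : (Formula.cmp c a.toTerm b.toTerm).fv ⊆ baseVars V := by
  simp only [Formula.fv, ETerm.fv_toTerm]
  exact Finset.union_subset (baseVars_mono ha) (baseVars_mono hb)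

namespace ETerm

variable {L : TermLanguage}

/-- Powers. -/
def npow (r : ETerm S) : ℕ → ETerm S
  | 0 => .const 1
  | m + 1 => .mul (npow r m) r

@[simp] theorem val_npow (v : Term S → ℝ) (r : ETerm S) (m : ℕ) :
    (npow r m).val v = r.val v ^ m := by
  induction m with
  | zero => simp [npow]
  | succ m ih => rw [npow, val_mul, ih, pow_succ]

theorem val_lie_npow (v : Term L.toSignature → ℝ) (σ : ℕ → L.ET) (r : L.ET) (m : ℕ) :
    (lie σ (npow r (m + 1))).val v = (m + 1) * r.val v ^ m * (lie σ r).val v := by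
  induction m with
  | zero => simp [npow]
  | succ m ih =>
    rw [npow, lie_mul, val_add, val_mul, val_mul, ih, val_npow]
    push_cast
    ring

/-- The `j`-th Lie derivative of `r ^ (k + 1)` is a multiple of `r ^ (k + 1 - j)`; this is the
other factor. -/
def powLieFactor (σ : ℕ → L.ET) (r : L.ET) (k : ℕ) : ℕ → L.ET
  | 0 => .const 1
  | j + 1 => .add (.mul (.const ((k + 1 - j : ℕ) : ℚ)) (.mul (lie σ r) (powLieFactor σ r k j)))
      (.mul r (lie σ (powLieFactor σ r k j)))

/-- The `j`-th Lie derivative of `s * p - r ^ (k + 1)`. -/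
def shifted (σ : ℕ → L.ET) (s : ℚ) (p r : L.ET) (k j : ℕ) : L.ET :=
  .add (.mul (.const s) ((lie σ)^[j] p))
    (.mul (.const (-1)) (.mul (npow r (k + 1 - j)) (powLieFactor σ r k j)))

/-- The product rule applied to `r ^ (k + 1 - j)` times its cofactor. The restriction `j ≤ k` keeps
the exponent positive, so the truncated subtraction is harmless. -/
theorem val_lie_shifted (v : Term L.toSignature → ℝ) (σ : ℕ → L.ET) (s : ℚ) (p r : L.ET)
    {k j : ℕ} (hj : j ≤ k) :
    (lie σ (shifted σ s p r k j)).val v = (shifted σ s p r k (j + 1)).val v := by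
  obtain ⟨m, rfl⟩ := Nat.exists_eq_add_of_le hj
  have h₁ : j + m + 1 - j = m + 1 := by omega
  have h₂ : j + m + 1 - (j + 1) = m := by omega
  rw [shifted, shifted, powLieFactor, h₁, h₂, Function.iterate_succ_apply']
  simp only [lie_add, lie_mul, lie_const, val_add, val_mul, val_const, val_lie_npow, val_npow]
  push_cast
  ring

end ETerm

namespace Provable

open Formula

variable {L : TermLanguage} {Γ : List (Formula L.toSignature)} {φ : Formula L.toSignature}

/-- Fresh variables may be assumed to be copies of the evolving variables. -/
theorem assume_copy {o : ODE L.toSignature} {ρ : ℕ → ℕ} {V : Finset ℕ} (hρ : o.FreshCopy ρ V)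
    (hΓ : ∀ χ ∈ Γ, χ.fv ⊆ baseVars V) (hφ : φ.fv ⊆ baseVars V)
    (h : Provable L ((eqVec o.lhs ρ).toFormula :: Γ) φ) : Provable L Γ φ := by
  -- Copies are introduced one variable at a time. The context varies because each new equation
  -- joins it, and distinctness of the copies keeps the remaining ones fresh.
  have key : ∀ (l : List ℕ) (Γ : List (Formula L.toSignature)), (l.map ρ).Nodup →
      (∀ n ∈ l, ∀ m ∈ l, ρ n ≠ m) → (∀ n ∈ l, ∀ χ ∈ Γ, Var.base (ρ n) ∉ χ.fv) →
      (∀ n ∈ l, Var.base (ρ n) ∉ φ.fv) →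
      Provable L ((eqVec l ρ).toFormula :: Γ) φ → Provable L Γ φ := by
    intro l
    induction l with
    | nil =>
      intro Γ _ _ _ _ h
      refine .cut _ (of_valid (eqVec [] ρ).qf_toFormula fun v => ?_) h
      simp [aholds_eqVec]
    | cons n l ih =>
      intro Γ hl hne hΓ hφ h
      rw [List.map_cons, List.nodup_cons] at hl
      refine fresh (Var.base (ρ n)) (.var (Var.base n)) ?_ (hΓ n (by simp)) (hφ n (by simp)) ?_
      · simpa [Term.fv, Var.base] using hne n (by simp) n (by simp)
      refine ih _ hl.2 (fun a ha b hb => hne a (by simp [ha]) b (by simp [hb])) ?_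
        (fun a ha => hφ a (by simp [ha])) ?_
      · intro m hm χ hχ
        rcases List.mem_cons.1 hχ with rfl | hχ
        · have h₁ : ρ m ≠ n := hne m (by simp [hm]) n (by simp)
          have h₂ : ρ m ≠ ρ n := fun h => hl.1 (h ▸ List.mem_map_of_mem hm)
          simp [Formula.eq, Formula.fv, Term.fv, Var.base, h₁, h₂]
        · exact hΓ m (by simp [hm]) χ hχ
      · refine of_hyps h fun δ hδ => ?_
        rcases List.mem_cons.1 hδ with rfl | hδ
        · refine arith_two head head.cons (SFml.qf_toFormula _) trivial (SFml.qf_toFormula _) ?_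
          intro v h₁ h₂
          rw [aholds_eqVec] at *
          intro m hm
          rcases List.mem_cons.1 hm with rfl | hm
          · exact h₂.symm
          · exact h₁ m hm
        · exact .hyp (by simp [hδ])
  have hn : ∀ n ∈ o.lhs, ∀ ψ : Formula L.toSignature, ψ.fv ⊆ baseVars V →
      Var.base (ρ n) ∉ ψ.fv := fun n hn ψ hψ hm =>
    hρ.2 n hn (Finset.mem_union_right _ (base_mem_baseVars.1 (hψ hm)))
  refine key o.lhs Γ hρ.1 ?_ (fun n h χ hχ => hn n h χ (hΓ χ hχ)) (fun n h => hn n h φ hφ) h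
  rintro n h m hm rfl
  exact hρ.2 n h (Finset.mem_union_left _ (ODE.mem_vars_of_mem_lhs hm))

/-- Continuous existence, for differential equations with a clock. -/
theorem progress {o : ODE L.toSignature} (hc : o.HasClock) {e : L.ET} {ρ : ℕ → ℕ}
    (hρ : o.FreshCopy ρ e.vars) (h₀ : Provable L Γ (eqVec o.lhs ρ).toFormula)
    (h : Provable L Γ (.cmp .gt e.toTerm (.const 0))) :
    Provable L Γ (.dia (.ode o (.cmp .gt e (.const 0))) (.not (eqVec o.lhs ρ).toFormula)) :=
  iff_mpr (mp (.ax (.cont o e ρ hc hρ)) h₀) h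

end Provable

/-! ### Necessity for differential equations: all Lie derivatives vanish. -/

namespace Provable

open Formula

variable {L : TermLanguage} {Γ : List (Formula L.toSignature)} {φ : Formula L.toSignature}

/-- A term that remains zero along a differential equation with an open domain cannot have a
nonzero first nonvanishing Lie derivative. -/
theorem not_lie_pos {o : ODE L.toSignature} (hc : o.HasClock) {Q : SFml L.toSignature} {a : L.ET}
    (hQ : ∀ v, Q.toFormula.aholds v ↔ a.val v ≠ 0) (p : L.ET) (s : ℚ) (k : ℕ) :
    Provable L (.cmp .gt (ETerm.mul (.const s) ((ETerm.lie o.rhs)^[k] p)).toTerm (.const 0) ::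
      Q.toFormula :: .box (.ode o Q) (eq p.toTerm (.const 0)) ::
      (List.range k).map fun j => eq ((ETerm.lie o.rhs)^[j] p).toTerm (.const 0)) fls := by
  obtain ⟨V, hV⟩ : ∃ V, V = o.vars ∪ Q.vars ∪ a.vars ∪ p.vars := ⟨_, rfl⟩
  have hVo : o.vars ⊆ V := by rw [hV]; intro n hn; simp [hn]
  have hVQ : Q.vars ⊆ V := by rw [hV]; intro n hn; simp [hn]
  have hVa : a.vars ⊆ V := by rw [hV]; intro n hn; simp [hn]
  have hVp : p.vars ⊆ V := by rw [hV]; intro n hn; simp [hn]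
  have hVl (j : ℕ) : ((ETerm.lie o.rhs)^[j] p).vars ⊆ V :=
    ETerm.vars_iterate_lie_subset hVp (fun n _ => (o.vars_rhs_subset n).trans hVo) j
  have hfls (W : Finset ℕ) : (fls : Formula L.toSignature).fv ⊆ baseVars W := by
    simp [fls, Formula.eq, Formula.fv, Term.fv]
  have hc0 (W : Finset ℕ) : (ETerm.const 0 : L.ET).vars ⊆ W := by simp [ETerm.vars]
  set Γ₀ : List (Formula L.toSignature) :=
    .cmp .gt (ETerm.mul (.const s) ((ETerm.lie o.rhs)^[k] p)).toTerm (.const 0) ::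
      Q.toFormula :: .box (.ode o Q) (eq p.toTerm (.const 0)) ::
      (List.range k).map fun j => eq ((ETerm.lie o.rhs)^[j] p).toTerm (.const 0) with hΓ₀
  have hfv₀ : ∀ χ ∈ Γ₀, χ.fv ⊆ baseVars V := by
    simp only [hΓ₀, List.mem_cons, forall_eq_or_imp, List.mem_map, forall_exists_index, and_imp,
      forall_apply_eq_imp_iff₂]
    refine ⟨fv_cmp_subset (b := .const 0) ?_ (hc0 V), ?_, ?_, fun j _ =>
      fv_cmp_subset (b := .const 0) (hVl j) (hc0 V)⟩
    · simpa [ETerm.vars] using hVl k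
    · rw [SFml.fv_toFormula]; exact baseVars_mono hVQ
    · exact Finset.union_subset (baseVars_mono (Finset.union_subset hVo hVQ))
        (Finset.sdiff_subset.trans (fv_cmp_subset (b := .const 0) hVp (hc0 V)))
  obtain ⟨ρ₁, hρ₁⟩ := o.exists_freshCopy V
  -- The squared distance from the initial point, which is stored in the copies `ρ₁`.
  obtain ⟨r, hr⟩ : ∃ r : L.ET, r = ETerm.sumSq (o.lhs.map fun n =>
    .add (.var n) (.mul (.const (-1)) (.var (ρ₁ n)))) := ⟨_, rfl⟩
  obtain ⟨E, hE⟩ : ∃ E : ℕ → L.ET, E = ETerm.shifted o.rhs s p r k := ⟨_, rfl⟩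
  obtain ⟨V₁, hV₁⟩ : ∃ V₁ : Finset ℕ, V₁ = V ∪ o.lhs.toFinset.image ρ₁ ∪ (E k).vars := ⟨_, rfl⟩
  have hVV₁ : V ⊆ V₁ := by rw [hV₁]; intro n hn; simp [hn]
  have hfvcopy (ρ : ℕ → ℕ) (W : Finset ℕ) (hW : V ⊆ W) (hρ : o.lhs.toFinset.image ρ ⊆ W) :
      ((eqVec o.lhs ρ : SFml L.toSignature).toFormula).fv ⊆ baseVars W := by
    rw [SFml.fv_toFormula]
    refine baseVars_mono ((vars_eqVec_subset _ _).trans (Finset.union_subset ?_ hρ))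
    exact fun n hn => hW (hVo (ODE.mem_vars_of_mem_lhs (List.mem_toFinset.1 hn)))
  -- A second copy of the initial point is needed: axiom `cont` requires its copies to be fresh for
  -- the tested term, but `E k` mentions the copies `ρ₁`.
  obtain ⟨ρ₂, hρ₂⟩ := o.exists_freshCopy V₁
  refine assume_copy hρ₁ hfv₀ (hfls V) (assume_copy hρ₂ ?_ (hfls V₁) ?_)
  · intro χ hχ
    rcases List.mem_cons.1 hχ with rfl | hχ
    · refine hfvcopy ρ₁ V₁ hVV₁ ?_
      rw [hV₁]
      exact fun n hn => Finset.mem_union_left _ (Finset.mem_union_right _ hn)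
    · exact (hfv₀ χ hχ).trans (baseVars_mono hVV₁)
  refine assume_primes ((Finset.range (k + 1)).biUnion fun j => (E j).vars).toList
    (Finset.nodup_toList _) ?_ (isBase_of_subset (hfls ∅)) ?_
  · simp only [List.mem_cons, forall_eq_or_imp]
    exact ⟨SFml.isBase_toFormula _, SFml.isBase_toFormula _,
      fun χ hχ => isBase_of_subset (hfv₀ χ hχ)⟩
  set Γ := ((Finset.range (k + 1)).biUnion fun j => (E j).vars).toList.map
      (fun n => eq (.var (Var.base n).prime) (.const 0)) ++
    (eqVec o.lhs ρ₂).toFormula :: (eqVec o.lhs ρ₁).toFormula :: Γ₀ with hΓ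
  have hprimes (j : ℕ) (hj : j ≤ k) (m : ℕ) (hm : m ∈ (E j).vars) :
      Provable L Γ (eq (.var (Var.base m).prime) (.const 0)) := by
    refine .hyp (List.mem_append_left _ (List.mem_map.2 ⟨m, Finset.mem_toList.2 ?_, rfl⟩))
    exact Finset.mem_biUnion.2 ⟨j, Finset.mem_range.2 (by omega), hm⟩
  have hcopy₁ : Provable L Γ (eqVec o.lhs ρ₁).toFormula := .hyp (by simp [hΓ])
  have hcopy₂ : Provable L Γ (eqVec o.lhs ρ₂).toFormula := .hyp (by simp [hΓ])
  have hpos : Provable L Γ (.cmp .gt (ETerm.mul (.const s) ((ETerm.lie o.rhs)^[k] p)).toTerm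
      (.const 0)) := .hyp (by simp [hΓ, hΓ₀])
  have hdom : Provable L Γ Q.toFormula := .hyp (by simp [hΓ, hΓ₀])
  have hbox : Provable L Γ (.box (.ode o Q) (eq p.toTerm (.const 0))) := .hyp (by simp [hΓ, hΓ₀])
  have hzero (j : ℕ) (hj : j < k) :
      Provable L Γ (eq ((ETerm.lie o.rhs)^[j] p).toTerm (.const 0)) := by
    -- Five formulas come first: the two copy equations, the sign condition, the domain and the box.
    refine .hyp (List.mem_append_right _ (.tail _ (.tail _ (.tail _ (.tail _ (.tail _ ?_))))))
    exact List.mem_map.2 ⟨j, List.mem_range.2 hj, rfl⟩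
  have hr0 (v) (h : ((eqVec o.lhs ρ₁ : SFml L.toSignature).toFormula).aholds v) :
      r.val v = 0 := by
    rw [hr, ETerm.val_sumSq_eq_zero]
    intro e he
    obtain ⟨n, hn, rfl⟩ := List.mem_map.1 he
    have := (aholds_eqVec v _ _).1 h n hn
    simp [this]
  have hE0 (v) (h : ((eqVec o.lhs ρ₁ : SFml L.toSignature).toFormula).aholds v) (j : ℕ)
      (hj : j ≤ k) : (E j).val v = s * ((ETerm.lie o.rhs)^[j] p).val v := by
    -- For `j ≤ k` a positive power of `r` is left in the `j`-th derivative of `r ^ (k + 1)`, so it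
    -- vanishes at the initial point.
    have : k + 1 - j ≠ 0 := by omega
    simp [hE, ETerm.shifted, hr0 v h, this]
  -- Both conjuncts are strict inequalities that hold initially, so `cont` applies to each and
  -- `uniq` combines them. The second one expresses `a ≠ 0` and so implies `Q`.
  obtain ⟨D, hD⟩ : ∃ D : SFml L.toSignature,
    D = .and (.cmp .gt (E k) (.const 0)) (.cmp .gt (.mul a a) (.const 0)) := ⟨_, rfl⟩
  have hDW : Provable L Γ (.box (.ode o D) D.toFormula) := .ax (.DW o D)
  have hp0 : Provable L Γ (.box (.ode o D) (eq p.toTerm (.const 0))) := by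
    refine mp (mp (.ax (.DMP o D Q _)) (.G _ ?_)) hbox
    refine of_valid ⟨D.qf_toFormula, Q.qf_toFormula⟩ fun v => ?_
    rw [aholds_imp, hQ, hD]
    rintro ⟨-, h⟩ h0
    simp [SFml.toFormula, Formula.aholds, Cmp.holds, Term.aeval, h0] at h
  have hEnonneg (i : ℕ) (hi : i ≤ k) :
      Provable L Γ (.box (.ode o D) (.cmp .ge (E (k - i)).toTerm (.const 0))) := by
    induction i with
    | zero =>
      refine box_one hDW (arith_one head D.qf_toFormula trivial fun v h => ?_)
      rw [hD] at h
      exact le_of_lt h.1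
    | succ i ih =>
      -- Descent from `E k` to `E 0`: each `E j` with `j < k` starts at zero and has the nonnegative
      -- derivative `E (j + 1)`.
      refine di_ge (fun m hm _ => hprimes _ (by omega) m hm) ?_ (box_one (ih (by omega)) ?_)
      · refine arith_two hcopy₁ (hzero (k - (i + 1)) (by omega)) (SFml.qf_toFormula _) trivial
          trivial fun v h₁ h₂ => ?_
        rw [aholds_eq, ETerm.aeval_toTerm] at h₂
        simp only [Formula.aholds, Cmp.holds, ETerm.aeval_toTerm]
        rw [hE0 v h₁ _ (by omega), h₂]
        simp [Term.aeval]
      · refine arith_one head trivial trivial fun v h => ?_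
        simp only [Formula.aholds, Cmp.holds, ETerm.aeval_toTerm] at h ⊢
        rw [hE, ETerm.val_lie_shifted _ _ _ _ _ (by omega), ← hE,
          show k - (i + 1) + 1 = k - i by omega]
        exact h
  -- Within `D`, `p = 0` turns `E 0 ≥ 0` into `r ^ (k + 1) ≤ 0`. So the state equals the `ρ₁` copy,
  -- and hence the `ρ₂` copy, as neither copy evolves.
  have hstay : Provable L Γ (.box (.ode o D) (.not (.not (eqVec o.lhs ρ₂).toFormula))) := by
    refine box_mono _ (eq p.toTerm (.const 0) :: .cmp .ge (E 0).toTerm (.const 0) ::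
      o.lhs.map fun n => eq (.var (Var.base (ρ₁ n))) (.var (Var.base (ρ₂ n)))) ?_ ?_
    · simp only [List.mem_cons, forall_eq_or_imp, List.mem_map, forall_exists_index, and_imp,
        forall_apply_eq_imp_iff₂]
      refine ⟨hp0, by simpa using hEnonneg k le_rfl, fun n hn => box_of_disjoint ?_ ?_⟩
      · refine arith_two hcopy₁ hcopy₂ (SFml.qf_toFormula _) (SFml.qf_toFormula _) trivial ?_
        intro v h₁ h₂
        rw [aholds_eqVec] at h₁ h₂
        exact (h₁ n hn).symm.trans (h₂ n hn)
      · have hnot (ρ : ℕ → ℕ) (W : Finset ℕ) (hρ : o.FreshCopy ρ W) :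
            Var.base (ρ n) ∉ (Program.ode o D).bv := by
          intro h
          rcases Finset.mem_union.1 h with h | h
          · exact hρ.2 n hn (Finset.mem_union_left _ (ODE.mem_vars_of_mem_lhs
              (List.mem_toFinset.1 (base_mem_baseVars.1 h))))
          · obtain ⟨x, -, hx⟩ := Finset.mem_image.1 h
            simp [Var.prime, Var.base] at hx
        simp only [Formula.eq, Formula.fv, Term.fv, Finset.disjoint_union_left,
          Finset.disjoint_singleton_left]
        exact ⟨hnot ρ₁ V hρ₁, hnot ρ₂ V₁ hρ₂⟩
    · refine arith _ (fun γ hγ => .hyp hγ) ?_ (SFml.qf_toFormula (eqVec o.lhs ρ₂)) fun v h => ?_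
      · simp only [List.mem_cons, forall_eq_or_imp, List.mem_map, forall_exists_index, and_imp,
          forall_apply_eq_imp_iff₂]
        exact ⟨trivial, trivial, fun _ _ => trivial⟩
      · simp only [List.mem_cons, forall_eq_or_imp, List.mem_map, forall_exists_index, and_imp,
          forall_apply_eq_imp_iff₂, aholds_eq, ETerm.aeval_toTerm, Term.aeval] at h
        obtain ⟨h₁, h₂, h₃⟩ := h
        simp only [Formula.aholds, not_not]
        rw [aholds_eqVec]
        simp only [Formula.aholds, Cmp.holds, Term.aeval, ETerm.aeval_toTerm, hE, ETerm.shifted,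
          ETerm.val_add, ETerm.val_mul, ETerm.val_const, ETerm.val_npow, ETerm.powLieFactor,
          Function.iterate_zero, id, h₁] at h₂
        push_cast at h₂
        have hrn : 0 ≤ r.val v := by rw [hr]; exact ETerm.val_sumSq_nonneg _ _
        have hrz : r.val v = 0 := by
          have : r.val v ^ (k + 1) ≤ 0 := by simpa using h₂
          exact pow_eq_zero_iff (n := k + 1) (by omega) |>.1
            (le_antisymm this (pow_nonneg hrn _))
        rw [hr, ETerm.val_sumSq_eq_zero] at hrz
        intro n hn
        have := hrz _ (List.mem_map_of_mem hn)
        simp only [ETerm.val_add, ETerm.val_mul, ETerm.val_const, ETerm.val_var] at this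
        push_cast at this
        linarith [h₃ n hn]
  have hmove : Provable L Γ (.dia (.ode o D) (.not (eqVec o.lhs ρ₂).toFormula)) := by
    rw [hD]
    refine iff_mpr (.ax (.uniq o _ _ _)) (.andR (progress hc (hρ₂.mono ?_) hcopy₂ ?_)
      (progress hc (hρ₂.mono ?_) hcopy₂ ?_))
    · rw [hV₁]; exact Finset.subset_union_right
    · refine arith_two hcopy₁ hpos (SFml.qf_toFormula _) trivial trivial fun v h₁ h₂ => ?_
      simp only [Formula.aholds, Cmp.holds, ETerm.aeval_toTerm] at h₂ ⊢
      rw [hE0 v h₁ k le_rfl]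
      exact h₂
    · exact Finset.union_subset (hVa.trans hVV₁) (hVa.trans hVV₁)
    · refine arith_one hdom Q.qf_toFormula trivial fun v h => ?_
      have := mul_self_pos.2 ((hQ v).1 h)
      simpa [Formula.aholds, Cmp.holds, Term.aeval] using this
  exact fls_of_not (iff_mp (.ax (.dual _ _)) hmove) hstay

/-- Both signs are excluded, by `s = 1` and `s = -1`. -/
theorem lie_eq_zero_of_clock {o : ODE L.toSignature} (hc : o.HasClock) {Q : SFml L.toSignature}
    {a : L.ET} (hQ : ∀ v, Q.toFormula.aholds v ↔ a.val v ≠ 0) (p : L.ET) (k : ℕ) :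
    Provable L (Q.toFormula :: .box (.ode o Q) (eq p.toTerm (.const 0)) ::
      (List.range k).map fun j => eq ((ETerm.lie o.rhs)^[j] p).toTerm (.const 0))
      (eq ((ETerm.lie o.rhs)^[k] p).toTerm (.const 0)) := by
  have key (s : ℚ) := Provable.notR (not_lie_pos hc hQ p s k)
  refine arith_two (key 1) (key (-1)) trivial trivial trivial fun v h₁ h₂ => ?_
  simp only [Formula.aholds, Cmp.holds, ETerm.aeval_toTerm, ETerm.val_mul, ETerm.val_const,
    Term.aeval, aholds_eq] at *
  push_cast at *
  linarith

/-- A fresh clock `t' = 1` is adjoined as a differential ghost; it leaves the Lie derivatives of `p`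
unchanged. -/
theorem lie_eq_zero (o : ODE L.toSignature) {Q : SFml L.toSignature}
    {a : L.ET} (hQ : ∀ v, Q.toFormula.aholds v ↔ a.val v ≠ 0) (p : L.ET) (k : ℕ) :
    Provable L (Q.toFormula :: .box (.ode o Q) (eq p.toTerm (.const 0)) ::
      (List.range k).map fun j => eq ((ETerm.lie o.rhs)^[j] p).toTerm (.const 0))
      (eq ((ETerm.lie o.rhs)^[k] p).toTerm (.const 0)) := by
  obtain ⟨t, ht⟩ := Infinite.exists_notMem_finset (o.vars ∪ Q.vars ∪ p.vars)
  simp only [Finset.mem_union, not_or] at ht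
  obtain ⟨⟨hto, htQ⟩, htp⟩ := ht
  obtain ⟨o', ho'⟩ : ∃ o', o' = o.extend t (.const 1) hto := ⟨_, rfl⟩
  have hc : o'.HasClock := ⟨(t, .const 1), by simp [ho'], rfl⟩
  have hlie (j : ℕ) : (ETerm.lie o'.rhs)^[j] p = (ETerm.lie o.rhs)^[j] p := by
    induction j with
    | zero => rfl
    | succ j ih =>
      rw [Function.iterate_succ_apply', Function.iterate_succ_apply', ih]
      refine ETerm.lie_congr fun n hn => ?_
      rw [ho', ODE.rhs_extend_of_ne]
      rintro rfl
      have : n ∈ o.vars ∪ p.vars := ETerm.vars_iterate_lie_subset Finset.subset_union_right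
        (fun n _ => (o.vars_rhs_subset n).trans Finset.subset_union_left) j hn
      exact (Finset.mem_union.1 this).elim hto htp
  have := lie_eq_zero_of_clock hc hQ p k
  simp only [hlie] at this
  refine of_hyps this fun δ hδ => ?_
  simp only [List.mem_cons] at hδ
  rcases hδ with rfl | rfl | hδ
  · exact head
  · refine all_self (x := Var.base t) (iff_mp (.ax (.DG_all o o' Q _ t (.const 1)
      ⟨.const 0, .const 1, ?_, ?_, .inr (.inr rfl)⟩ (by rw [ho']; rfl) ?_ ?_ ?_)) head.cons)
    · simp [ETerm.vars]
    · simp [ETerm.vars]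
    · simp [hto, htQ]
    · simpa [Formula.eq, Formula.fv, Term.fv, ETerm.base_mem_fv] using htp
    · exact (isBase_cmp .eq p (.const 0)).prime_notMem t
  · exact .hyp (by simp [hδ])

theorem orbit_eq_zero (o : ODE L.toSignature) {Q : SFml L.toSignature}
    {a : L.ET} (hQ : ∀ v, Q.toFormula.aholds v ↔ a.val v ≠ 0) (p : L.ET) (k : ℕ) :
    Provable L [Q.toFormula, .box (.ode o Q) (eq p.toTerm (.const 0))]
      (eq ((ETerm.lie o.rhs)^[k] p).toTerm (.const 0)) := by
  induction k using Nat.strong_induction_on with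
  | _ k ih =>
    refine of_hyps (lie_eq_zero o hQ p k) fun δ hδ => ?_
    simp only [List.mem_cons, List.mem_map, List.mem_range] at hδ
    rcases hδ with rfl | rfl | ⟨j, hj, rfl⟩
    · exact head
    · exact head.cons
    · exact ih j hj

/-- Differential radical invariants are complete for open domains. -/
theorem box_ode_iff (o : ODE L.toSignature) {Q : SFml L.toSignature} {a : L.ET}
    (hQ : ∀ v, Q.toFormula.aholds v ↔ a.val v ≠ 0) (p : L.ET) (n : ℕ) (gs : List L.ET)
    (hgs : Provable L [] (eq ((ETerm.lie o.rhs)^[n + 1] p).toTerm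
      (combination gs (orbit (ETerm.lie o.rhs) p n)).toTerm)) :
    Provable L [] (iff (.box (.ode o Q) (eq p.toTerm (.const 0)))
      (eq (ETerm.mul a (ETerm.sumSq (orbit (ETerm.lie o.rhs) p n))).toTerm (.const 0))) := by
  -- Inside the domain `a ≠ 0` may be cancelled. Outside it `a = 0` makes the right-hand side true,
  -- and the box holds vacuously by `DX`.
  refine iff_intro (cases_on Q.toFormula ?_ ?_) (cases_on Q.toFormula ?_ ?_)
  · refine arith ((orbit (ETerm.lie o.rhs) p n).map fun e => eq e.toTerm (.const 0))
      ?_ ?_ trivial fun v hv => ?_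
    · simp only [List.mem_map, mem_orbit]
      rintro _ ⟨_, ⟨i, -, rfl⟩, rfl⟩
      exact orbit_eq_zero o hQ p i
    · simp only [List.mem_map]
      rintro _ ⟨_, -, rfl⟩
      trivial
    · simp only [List.mem_map, forall_exists_index, and_imp, forall_apply_eq_imp_iff₂, aholds_eq,
        ETerm.aeval_toTerm, Term.aeval] at hv
      have := (ETerm.val_sumSq_eq_zero v).2 fun e he => by simpa using hv e he
      simp [this, Term.aeval]
  · refine arith_one head Q.qf_toFormula trivial fun v h => ?_
    rw [Formula.aholds, hQ, not_not] at h
    simp [h, Term.aeval]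
  · refine of_hyps (box_eq_zero_of_orbit o Q p n gs hgs) fun δ hδ => ?_
    rw [List.mem_singleton.1 hδ]
    refine arith_two head head.cons Q.qf_toFormula trivial trivial fun v h₁ h₂ => ?_
    simpa [Term.aeval, (hQ v).1 h₁] using h₂
  · refine iff_mpr (.ax (.DX o Q _ fun n _ => (isBase_cmp .eq p (.const 0)).prime_notMem n))
      (.impR (of_fls (fls_of_not head.cons head)))

end Provable

/-! ### Analytic formulas as single equations -/

/-- A term whose zeros are the solutions of an analytic formula. -/
def SFml.eqTerm : SFml S → ETerm S
  | .cmp _ a b => .add a (.mul (.const (-1)) b)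
  | .and P Q => .add (.mul P.eqTerm P.eqTerm) (.mul Q.eqTerm Q.eqTerm)
  | .or P Q => .mul P.eqTerm Q.eqTerm
  | .not _ => .const 0

theorem SFml.IsAnalytic.aholds_iff {P : SFml S} (hP : P.IsAnalytic) (v : Term S → ℝ) :
    P.toFormula.aholds v ↔ P.eqTerm.val v = 0 := by
  induction P with
  | cmp c a b =>
    cases c with
    | eq =>
      simp only [toFormula, Formula.aholds, Cmp.holds, eqTerm, ETerm.aeval_toTerm, ETerm.val_add,
        ETerm.val_mul, ETerm.val_const]
      push_cast
      constructor <;> intro h <;> linarith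
    | ge => exact hP.elim
    | gt => exact hP.elim
  | and P Q ihP ihQ =>
    simp only [toFormula, Formula.aholds, eqTerm, ETerm.val_add, ETerm.val_mul, ihP hP.1, ihQ hP.2]
    constructor
    · rintro ⟨h₁, h₂⟩; simp [h₁, h₂]
    · intro h
      have h₁ := mul_self_nonneg (P.eqTerm.val v)
      have h₂ := mul_self_nonneg (Q.eqTerm.val v)
      exact ⟨mul_self_eq_zero.1 (by linarith), mul_self_eq_zero.1 (by linarith)⟩
  | or P Q ihP ihQ =>
    simp [toFormula, Formula.aholds, eqTerm, ihP hP.1, ihQ hP.2]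
  | not P => exact hP.elim

theorem SFml.IsAnalytic.aholds_not_iff {P : SFml S} (hP : P.IsAnalytic) (v : Term S → ℝ) :
    (SFml.not P).toFormula.aholds v ↔ P.eqTerm.val v ≠ 0 :=
  not_congr (hP.aholds_iff v)

/-! ### Equivalences for the program constructs. -/

namespace Provable

open Formula

variable {L : TermLanguage} {α β : Program L.toSignature}

theorem box_assign_iff (x : Var) (e t : L.ET) :
    Provable L [] (iff (.box (.assign x e) (eq t.toTerm (.const 0)))
      (eq (t.bind (single x e)).toTerm (.const 0))) := by
  rw [← ETerm.toTerm_subst]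
  exact .ax (.assign x e (eq t.toTerm (.const 0)) ⟨ETerm.freeFor_toTerm x t, trivial⟩)

theorem box_test_iff {Q : SFml L.toSignature} {a : L.ET}
    (hQ : ∀ v, Q.toFormula.aholds v ↔ a.val v ≠ 0) (t : L.ET) :
    Provable L [] (iff (.box (.test Q) (eq t.toTerm (.const 0)))
      (eq (ETerm.mul a t).toTerm (.const 0))) := by
  refine iff_trans (.ax (.test Q _)) (of_valid ?_ fun v => ?_)
  · exact ⟨⟨⟨Q.qf_toFormula, trivial⟩, trivial⟩, trivial, Q.qf_toFormula, trivial⟩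
  · rw [aholds_iff, aholds_imp, hQ]
    simp only [aholds_eq, ETerm.aeval_toTerm, Term.aeval, ETerm.val_mul]
    push_cast
    rw [mul_eq_zero]
    tauto

theorem box_choice_iff {t a b : L.ET}
    (hα : Provable L [] (iff (.box α (eq t.toTerm (.const 0))) (eq a.toTerm (.const 0))))
    (hβ : Provable L [] (iff (.box β (eq t.toTerm (.const 0))) (eq b.toTerm (.const 0)))) :
    Provable L [] (iff (.box (.choice α β) (eq t.toTerm (.const 0)))
      (eq (ETerm.sumSq [a, b]).toTerm (.const 0))) := by
  have key (v) : (ETerm.sumSq [a, b]).val v = 0 ↔ a.val v = 0 ∧ b.val v = 0 := by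
    rw [ETerm.val_sumSq_eq_zero]; simp
  refine iff_trans (.ax (.choice α β _)) (iff_intro ?_ (.andR ?_ ?_))
  · refine arith_two (iff_mp hα.closed (and_left head)) (iff_mp hβ.closed (and_right head)) trivial
      trivial trivial fun v h₁ h₂ => ?_
    rw [aholds_eq, ETerm.aeval_toTerm] at *
    exact ((key v).2 ⟨by simpa [Term.aeval] using h₁, by simpa [Term.aeval] using h₂⟩).trans
      (by simp [Term.aeval])
  · refine iff_mpr hα.closed (arith_one head trivial trivial fun v h => ?_)
    rw [aholds_eq, ETerm.aeval_toTerm] at *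
    exact ((key v).1 (by simpa [Term.aeval] using h)).1.trans (by simp [Term.aeval])
  · refine iff_mpr hβ.closed (arith_one head trivial trivial fun v h => ?_)
    rw [aholds_eq, ETerm.aeval_toTerm] at *
    exact ((key v).1 (by simpa [Term.aeval] using h)).2.trans (by simp [Term.aeval])

theorem box_seq_iff {t a b : L.ET}
    (hβ : Provable L [] (iff (.box β (eq t.toTerm (.const 0))) (eq b.toTerm (.const 0))))
    (hα : Provable L [] (iff (.box α (eq b.toTerm (.const 0))) (eq a.toTerm (.const 0)))) :
    Provable L [] (iff (.box (.seq α β) (eq t.toTerm (.const 0))) (eq a.toTerm (.const 0))) :=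
  iff_trans (.ax (.compose α β _)) (iff_trans (box_iff hβ) hα)

theorem box_star_iff {F : L.ET → L.ET} {t : L.ET} {n : ℕ} {gs : List L.ET}
    (hF : ∀ e, Provable L [] (iff (.box α (eq e.toTerm (.const 0))) (eq (F e).toTerm (.const 0))))
    (hgs : Provable L [] (eq (F^[n + 1] t).toTerm (combination gs (orbit F t n)).toTerm)) :
    Provable L [] (iff (.box (.star α) (eq t.toTerm (.const 0)))
      (eq (ETerm.sumSq (orbit F t n)).toTerm (.const 0))) := by
  have hall {Γ} (h : ∀ i ≤ n, Provable L Γ (eq (F^[i] t).toTerm (.const 0))) :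
      Provable L Γ (eq (ETerm.sumSq (orbit F t n)).toTerm (.const 0)) := by
    refine arith ((orbit F t n).map fun e => eq e.toTerm (.const 0)) ?_ ?_ trivial fun v hv => ?_
    · simp only [List.mem_map, mem_orbit]
      rintro _ ⟨_, ⟨i, hi, rfl⟩, rfl⟩
      exact h i hi
    · simp only [List.mem_map]
      rintro _ ⟨_, -, rfl⟩
      trivial
    · simp only [List.mem_map, forall_exists_index, and_imp, forall_apply_eq_imp_iff₂, aholds_eq,
        ETerm.aeval_toTerm, Term.aeval] at hv
      have := (ETerm.val_sumSq_eq_zero v).2 fun e he => by simpa using hv e he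
      simp [this, Term.aeval]
  have hone {Γ} (h : Provable L Γ (eq (ETerm.sumSq (orbit F t n)).toTerm (.const 0))) (i : ℕ)
      (hi : i ≤ n) : Provable L Γ (eq (F^[i] t).toTerm (.const 0)) := by
    refine arith_one h trivial trivial fun v hv => ?_
    simp only [aholds_eq, ETerm.aeval_toTerm, Term.aeval] at hv ⊢
    have := (ETerm.val_sumSq_eq_zero v).1 (by simpa using hv) _ (mem_orbit.2 ⟨i, hi, rfl⟩)
    simpa using this
  refine iff_intro (hall fun i _ => ?_) ?_
  · induction i with
    | zero => exact and_left (iff_mp (.ax (.iterate α _)) head)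
    -- Unfolding the loop once puts `[α*] t = 0` after `α`; there the induction hypothesis gives
    -- `F^[i] t = 0`, and `hF` turns this into `F^[i + 1] t = 0` now.
    | succ i ih =>
      rw [Function.iterate_succ_apply']
      refine iff_mp (hF _).closed (box_one (and_right (iff_mp (.ax (.iterate α _)) head)) ?_)
      exact ih (by omega)
  · refine box_one (ψ := eq (ETerm.sumSq (orbit F t n)).toTerm (.const 0)) ?_
      (hone head 0 n.zero_le)
    -- The loop invariant is the vanishing of the whole orbit. After `α`, `F^[i] t = 0` is required,
    -- that is, `F^[i + 1] t = 0` before it; only `i = n` leaves the orbit, and there the identity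
    -- `hgs` applies.
    refine iff_mpr (.ax (.induction α _)) (.andR head (.G _ (.impR ?_)))
    refine box_mono α ((orbit F t n).map fun e => eq e.toTerm (.const 0)) ?_ (hall fun i hi => ?_)
    · simp only [List.mem_map, mem_orbit]
      rintro _ ⟨_, ⟨i, hi, rfl⟩, rfl⟩
      refine iff_mpr (hF _).closed ?_
      rw [← Function.iterate_succ_apply' F]
      rcases Nat.lt_or_ge i n with h | h
      · exact hone head (i + 1) h
      · obtain rfl : i = n := le_antisymm hi h
        refine arith_two hgs.closed head trivial trivial trivial fun v h₁ h₂ => ?_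
        simp only [aholds_eq, ETerm.aeval_toTerm, Term.aeval] at h₁ h₂ ⊢
        have h₃ := ETerm.sq_val_combination_le v gs (orbit F t i)
        rw [show (ETerm.sumSq (orbit F t i)).val v = 0 by simpa using h₂, mul_zero] at h₃
        rw [h₁, pow_eq_zero_iff two_ne_zero |>.1 (le_antisymm h₃ (sq_nonneg _))]
        simp
    · exact .hyp (List.mem_map.2 ⟨_, mem_orbit.2 ⟨i, hi, rfl⟩, rfl⟩)

end Provable

/-! ### Ascending chains of ideals of extended terms -/

theorem TermLanguage.IsNoetherian.exists_inIdeal {L : TermLanguage} (hN : L.IsNoetherian)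
    {V : Finset ℕ} {F : L.ET → L.ET} {t : L.ET} (hV : ∀ i, (F^[i] t).vars ⊆ V) :
    ∃ n, L.InIdeal (F^[n + 1] t) (orbit F t n) := by
  have := hN V
  let a : ℕ → L.termRing V := fun i => ⟨fun v => (F^[i] t).eval L.interp v, F^[i] t, hV i,
    fun _ => rfl⟩
  -- Every ring element is denoted by some term, so ideal coefficients become syntactic cofactors,
  -- in the latest-first order of `orbit`.
  have hspan : ∀ n : ℕ, ∀ x ∈ Ideal.span (a '' Set.Iic n), ∃ gs : List L.ET,
      gs.length = (orbit F t n).length ∧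
        ∀ v, x.1 v = (combination gs (orbit F t n)).eval L.interp v := by
    intro n
    induction n with
    | zero =>
      intro x hx
      rw [show Set.Iic 0 = {0} by ext; simp, Set.image_singleton, Ideal.mem_span_singleton'] at hx
      obtain ⟨⟨y, g, -, hg⟩, rfl⟩ := hx
      refine ⟨[g], rfl, fun v => ?_⟩
      simp [orbit, combination, ETerm.eval, a, hg]
    | succ n ih =>
      intro x hx
      rw [show Set.Iic (n + 1) = insert (n + 1) (Set.Iic n) by ext; simp; omega, Set.image_insert_eq,
        Ideal.mem_span_insert] at hx
      obtain ⟨⟨y, g, -, hg⟩, z, hz, rfl⟩ := hx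
      obtain ⟨gs, hlen, hgs⟩ := ih z hz
      refine ⟨g :: gs, by simp [orbit, hlen], fun v => ?_⟩
      change y v * (F^[n + 1] t).eval L.interp v + z.1 v = _
      rw [hgs v, hg v]
      rfl
  obtain ⟨n, hn⟩ := monotone_stabilizes_iff_noetherian.2 this
    ⟨fun n => Ideal.span (a '' Set.Iic n),
      fun i j hij => Ideal.span_mono (Set.image_mono (Set.Iic_subset_Iic.2 hij))⟩
  obtain ⟨gs, hlen, hgs⟩ := hspan n (a (n + 1)) (by
    have h : Ideal.span (a '' Set.Iic n) = Ideal.span (a '' Set.Iic (n + 1)) := hn (n + 1) (by simp)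
    rw [h]
    exact Ideal.subset_span ⟨n + 1, by simp, rfl⟩)
  exact ⟨n, gs, hlen, hgs⟩

/-! ### A small language of recursive programs -/

/-- Expressions over natural numbers with pairing, branching on equality, local definitions, calls
of given partial recursive functions, and recursive calls. -/
inductive RecExpr : Type
  | inp : RecExpr
  | lit (n : ℕ) : RecExpr
  | pair (a b : RecExpr) : RecExpr
  | fst (a : RecExpr) : RecExpr
  | snd (a : RecExpr) : RecExpr
  | succ (a : RecExpr) : RecExpr
  | pred (a : RecExpr) : RecExpr
  | ifEq (a b c d : RecExpr) : RecExpr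
  | letIn (a b : RecExpr) : RecExpr
  | prim (f : ℕ →. ℕ) (hf : Partrec f) (a : RecExpr) : RecExpr
  | self (a : RecExpr) : RecExpr

namespace RecExpr

/-- The value of an expression for a given meaning of recursive calls. -/
def eval (F : ℕ →. ℕ) : RecExpr → ℕ →. ℕ
  | .inp, x => Part.some x
  | .lit n, _ => Part.some n
  | .pair a b, x => (a.eval F x).bind fun u => (b.eval F x).bind fun v => Part.some (Nat.pair u v)
  | .fst a, x => (a.eval F x).bind fun u => Part.some u.unpair.1
  | .snd a, x => (a.eval F x).bind fun u => Part.some u.unpair.2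
  | .succ a, x => (a.eval F x).bind fun u => Part.some (u + 1)
  | .pred a, x => (a.eval F x).bind fun u => Part.some (u - 1)
  | .ifEq a b c d, x => (a.eval F x).bind fun u => (b.eval F x).bind fun v =>
      bif u == v then c.eval F x else d.eval F x
  | .letIn a b, x => (a.eval F x).bind fun u => b.eval F (Nat.pair u x)
  | .prim f _ a, x => (a.eval F x).bind f
  | .self a, x => (a.eval F x).bind F

-- Partial recursiveness uniformly in a code `c` for the recursive calls, which is what the
-- recursion theorem needs for a fixed point.
open Nat.Partrec in
theorem partrec_eval (e : RecExpr) : Partrec₂ fun (c : Code) (x : ℕ) => e.eval c.eval x := by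
  induction e with
  | inp => exact Computable.snd.partrec
  | lit n => exact (Computable.const n).partrec
  | pair a b iha ihb =>
    refine Partrec.bind iha (Partrec.bind (ihb.comp (.comp .fst .fst) (.comp .snd .fst)) ?_)
    exact (Primrec₂.natPair.to_comp.comp (Computable.snd.comp Computable.fst)
      Computable.snd).partrec
  | fst a ih =>
    exact Partrec.bind ih
      (Computable.fst.comp (Computable.unpair.comp Computable.snd)).partrec
  | snd a ih =>
    exact Partrec.bind ih
      (Computable.snd.comp (Computable.unpair.comp Computable.snd)).partrec
  | succ a ih => exact Partrec.bind ih (Computable.succ.comp Computable.snd).partrec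
  | pred a ih => exact Partrec.bind ih (Computable.pred.comp Computable.snd).partrec
  | ifEq a b c d iha ihb ihc ihd =>
    refine Partrec.bind iha (Partrec.bind (ihb.comp (.comp .fst .fst) (.comp .snd .fst)) ?_)
    refine Partrec.cond ?_ (ihc.comp (.comp .fst (.comp .fst .fst)) (.comp .snd (.comp .fst .fst)))
      (ihd.comp (.comp .fst (.comp .fst .fst)) (.comp .snd (.comp .fst .fst)))
    exact (Primrec.beq.comp (Primrec.snd.comp Primrec.fst) Primrec.snd).to_comp
  | letIn a b iha ihb =>
    refine Partrec.bind iha (Partrec₂.comp (f := fun (c : Code) (x : ℕ) => b.eval c.eval x) ihb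
      (Computable.fst.comp Computable.fst) ?_)
    exact (Primrec₂.natPair.to_comp.comp Computable.snd (Computable.snd.comp Computable.fst))
  | prim f hf a ih => exact Partrec.bind ih (hf.comp Computable.snd)
  | self a ih =>
    exact Partrec.bind ih (Code.eval_part.comp (Computable.fst.comp Computable.fst) Computable.snd)

/-- Every expression defines a partial recursive function by recursion. -/
theorem exists_partrec (e : RecExpr) : ∃ F : ℕ →. ℕ, Partrec F ∧ ∀ x, F x = e.eval F x := by
  obtain ⟨c, hc⟩ := Nat.Partrec.Code.fixed_point₂ e.partrec_eval
  exact ⟨c.eval, Nat.Partrec.Code.eval_part.comp (Computable.const c) Computable.id,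
    fun x => congrFun hc x⟩

end RecExpr

namespace RecExpr

variable (F : ℕ →. ℕ) (x : ℕ)

section simp_lemmas

variable (a b c d : RecExpr)

@[simp] theorem eval_inp : inp.eval F x = Part.some x := rfl
@[simp] theorem eval_lit (n : ℕ) : (lit n).eval F x = Part.some n := rfl
@[simp] theorem eval_pair : (pair a b).eval F x =
    (a.eval F x).bind fun u => (b.eval F x).bind fun v => Part.some (Nat.pair u v) := rfl
@[simp] theorem eval_fst :
    (fst a).eval F x = (a.eval F x).bind fun u => Part.some u.unpair.1 := rfl
@[simp] theorem eval_snd :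
    (snd a).eval F x = (a.eval F x).bind fun u => Part.some u.unpair.2 := rfl
@[simp] theorem eval_succ : (succ a).eval F x = (a.eval F x).bind fun u => Part.some (u + 1) := rfl
@[simp] theorem eval_pred : (pred a).eval F x = (a.eval F x).bind fun u => Part.some (u - 1) := rfl
@[simp] theorem eval_ifEq : (ifEq a b c d).eval F x =
    (a.eval F x).bind fun u => (b.eval F x).bind fun v =>
      bif u == v then c.eval F x else d.eval F x := rfl
@[simp] theorem eval_letIn :
    (letIn a b).eval F x = (a.eval F x).bind fun u => b.eval F (Nat.pair u x) := rfl
@[simp] theorem eval_prim (f : ℕ →. ℕ) (hf : Partrec f) :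
    (prim f hf a).eval F x = (a.eval F x).bind f := rfl
@[simp] theorem eval_self : (self a).eval F x = (a.eval F x).bind F := rfl

end simp_lemmas

@[simp] theorem bind_some_pfun (f : ℕ →. ℕ) (n : ℕ) : Part.bind (Part.some n) f = f n :=
  Part.bind_some n f

/-- The head of a nonempty list. -/
def hd (l : RecExpr) : RecExpr := fst (pred l)

/-- The tail of a nonempty list. -/
def tl (l : RecExpr) : RecExpr := snd (pred l)

/-- A list with the given head and tail. -/
def cons (a l : RecExpr) : RecExpr := succ (pair a l)

/-- A pair that is marked by a number. -/
def tag (n : ℕ) (a b : RecExpr) : RecExpr := pair (lit n) (pair a b)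

end RecExpr

/-! ### Association lists -/

/-- Look up a key in a list of pairs of numbers, with a default value. -/
def assocGet (d : ℕ) : List ℕ → ℕ → ℕ
  | [], _ => d
  | p :: l, n => if p.unpair.1 = n then p.unpair.2 else assocGet d l n

/-- Pair the members of a list with their positions. -/
def enumPairs : ℕ → List ℕ → List ℕ
  | _, [] => []
  | i, a :: l => Nat.pair i a :: enumPairs (i + 1) l

theorem assocGet_enumPairs (d : ℕ) (l : List ℕ) (i j : ℕ) (hj : j < l.length) :
    assocGet d (enumPairs i l) (i + j) = l[j] := by
  induction l generalizing i j with
  | nil => simp at hj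
  | cons a l ih =>
    cases j with
    | zero => simp [enumPairs, assocGet]
    | succ j =>
      have : i ≠ i + (j + 1) := by omega
      simp only [enumPairs, assocGet, Nat.unpair_pair, if_neg this, List.getElem_cons_succ]
      rw [← ih (i + 1) j (by simpa using hj)]
      congr 1
      omega

theorem assocGet_of_mem {d k v : ℕ} {l : List ℕ} (h : Nat.pair k v ∈ l)
    (hl : ∀ p ∈ l, p.unpair.1 = k → p.unpair.2 = v) : assocGet d l k = v := by
  induction l with
  | nil => simp at h
  | cons p l ih =>
    rw [assocGet]
    split
    · next hp => exact hl p (by simp) hp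
    · next hp =>
      rcases List.mem_cons.1 h with rfl | h
      · simp at hp
      · exact ih h fun q hq => hl q (by simp [hq])

open RecExpr in
theorem exists_lookup : ∃ F : ℕ →. ℕ, Partrec F ∧ ∀ (d : ℕ) (l : List ℕ) (n : ℕ),
    F (Nat.pair d (Nat.pair (Encodable.encode l) n)) = Part.some (assocGet d l n) := by
  -- The empty list is encoded by `0` and a nonempty one by the successor of a pair. Comparison with
  -- `0` therefore tests for emptiness, here and in the programs below.
  obtain ⟨F, hF, h⟩ := exists_partrec
    (ifEq (fst (snd inp)) (lit 0) (fst inp)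
      (ifEq (fst (hd (fst (snd inp)))) (snd (snd inp)) (snd (hd (fst (snd inp))))
        (self (pair (fst inp) (pair (tl (fst (snd inp))) (snd (snd inp)))))))
  refine ⟨F, hF, fun d l n => ?_⟩
  induction l with
  | nil => rw [h]; simp [assocGet]
  | cons p l ih =>
    rw [h]
    by_cases hp : p.unpair.1 = n
    · simp [hd, assocGet, hp]
    · simp [hd, tl, assocGet, hp, ih, beq_eq_false_iff_ne.2 hp]

open RecExpr in
theorem exists_enumPairs : ∃ F : ℕ →. ℕ, Partrec F ∧ ∀ (i : ℕ) (l : List ℕ),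
    F (Nat.pair i (Encodable.encode l)) = Part.some (Encodable.encode (enumPairs i l)) := by
  obtain ⟨F, hF, h⟩ := exists_partrec
    (ifEq (snd inp) (lit 0) (lit 0)
      (cons (pair (fst inp) (hd (snd inp))) (self (pair (succ (fst inp)) (tl (snd inp))))))
  refine ⟨F, hF, fun i l => ?_⟩
  induction l generalizing i with
  | nil => rw [h]; simp [enumPairs]
  | cons p l ih => rw [h]; simp [hd, tl, RecExpr.cons, enumPairs, ih]

/-! ### Operations on extended terms -/

section

open ETerm

-- The substitution is passed as an association list. The default `Nat.pair 0 n` is the code of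
-- variable `n`, so unlisted variables are left alone.
open RecExpr in
theorem exists_bind : ∃ F : ℕ →. ℕ, Partrec F ∧
    ∀ (l : List ℕ) (σ : ℕ → ETerm S) (e : ETerm S),
      (∀ n ∈ e.vars, assocGet (Nat.pair 0 n) l n = (σ n).code) →
        F (Nat.pair (Encodable.encode l) e.code) = Part.some (e.bind σ).code := by
  obtain ⟨G, hG, hG'⟩ := exists_lookup
  let env := RecExpr.fst inp
  let t := RecExpr.snd inp
  let body := RecExpr.snd t
  obtain ⟨F, hF, h⟩ := exists_partrec
    (ifEq (fst t) (lit 0) (prim G hG (pair t (pair env body)))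
    (ifEq (fst t) (lit 1) t
    (ifEq (fst t) (lit 2) (tag 2 (self (pair env (fst body))) (self (pair env (snd body))))
    (ifEq (fst t) (lit 3) (tag 3 (self (pair env (fst body))) (self (pair env (snd body))))
    -- Applications pass their argument list to the same function under the tag `5`, which no term
    -- code uses.
    (ifEq (fst t) (lit 4)
      (tag 4 (fst body) (self (pair env (pair (lit 5) (snd body)))))
    (ifEq body (lit 0) (lit 0)
      (RecExpr.cons (self (pair env (hd body))) (self (pair env (pair (lit 5) (tl body)))))))))))
  refine ⟨F, hF, fun l σ e he => ?_⟩
  have hlist (ts : List (ETerm S))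
      (ht : ∀ t ∈ ts, F (Nat.pair (Encodable.encode l) t.code) = Part.some (t.bind σ).code) :
      F (Nat.pair (Encodable.encode l) (Nat.pair 5 (Encodable.encode (ts.map code)))) =
        Part.some (Encodable.encode (ts.map fun t => (t.bind σ).code)) := by
    induction ts with
    | nil => rw [h]; simp [env, t, body]
    | cons a ts ih =>
      rw [h]
      simp [env, t, body, hd, tl, RecExpr.cons, ih fun t ht' => ht t (by simp [ht']),
        ht a (by simp)]
  induction e with
  | var n =>
    rw [h]
    have := he n (by simp [vars])
    simp [env, t, body, ETerm.code, ETerm.bind, hG', this]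
  | const c => rw [h]; simp [t, ETerm.code, ETerm.bind]
  | add a b iha ihb =>
    simp only [vars, Finset.mem_union] at he
    rw [h]
    simp [env, t, body, tag, ETerm.code, ETerm.bind, iha fun n hn => he n (.inl hn),
      ihb fun n hn => he n (.inr hn)]
  | mul a b iha ihb =>
    simp only [vars, Finset.mem_union] at he
    rw [h]
    simp [env, t, body, tag, ETerm.code, ETerm.bind, iha fun n hn => he n (.inl hn),
      ihb fun n hn => he n (.inr hn)]
  | app f args ih =>
    simp only [vars, Finset.mem_biUnion] at he
    have := hlist (List.ofFn args) (by
      simp only [List.mem_ofFn, forall_exists_index, forall_apply_eq_imp_iff]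
      exact fun i => ih i fun n hn => he n ⟨i, Finset.mem_univ i, hn⟩)
    rw [List.map_ofFn, List.map_ofFn] at this
    rw [h]
    simp only [ETerm.code, ETerm.bind]
    simp [env, t, body, tag]
    simp [Function.comp_def] at this
    simp [this]

open RecExpr in
theorem exists_sumSq : ∃ F : ℕ →. ℕ, Partrec F ∧ ∀ l : List (ETerm S),
    F (Encodable.encode (l.map code)) = Part.some (sumSq l).code := by
  obtain ⟨F, hF, h⟩ := exists_partrec
    (ifEq inp (lit 0) (lit (ETerm.const 0 : ETerm S).code)
      (tag 2 (tag 3 (hd inp) (hd inp)) (self (tl inp))))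
  refine ⟨F, hF, fun l => ?_⟩
  induction l with
  | nil => rw [h]; simp
  | cons e l ih =>
    rw [h]
    simp [hd, tl, tag, ih, ETerm.code]

-- The program copies the default values of `SFml.eqTerm` for non-analytic input, so analyticity
-- plays no role at this stage.
open RecExpr in
theorem exists_eqTerm : ∃ F : ℕ →. ℕ, Partrec F ∧ ∀ P : SFml S,
    F P.code = Part.some P.eqTerm.code := by
  let body := RecExpr.snd inp
  obtain ⟨F, hF, h⟩ := exists_partrec
    (ifEq (fst inp) (lit 0)
      (tag 2 (fst (snd body)) (tag 3 (lit (ETerm.const (-1) : ETerm S).code) (snd (snd body))))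
    (ifEq (fst inp) (lit 1)
      (tag 2 (tag 3 (self (fst body)) (self (fst body))) (tag 3 (self (snd body)) (self (snd body))))
    (ifEq (fst inp) (lit 2) (tag 3 (self (fst body)) (self (snd body)))
      (lit (ETerm.const 0 : ETerm S).code))))
  refine ⟨F, hF, fun P => ?_⟩
  induction P with
  | cmp c a b => rw [h]; simp [body, tag, SFml.code, SFml.eqTerm, ETerm.code]
  | and P Q ihP ihQ => rw [h]; simp [body, tag, SFml.code, SFml.eqTerm, ETerm.code, ihP, ihQ]
  | or P Q ihP ihQ => rw [h]; simp [body, tag, SFml.code, SFml.eqTerm, ETerm.code, ihP, ihQ]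
  | not P => rw [h]; simp [SFml.code, SFml.eqTerm]

theorem assocGet_sys (l : List (ℕ × ETerm S)) (n : ℕ) :
    assocGet (ETerm.const 0 : ETerm S).code (l.map fun p => Nat.pair p.1 p.2.code) n =
      (rhsOf l n).code := by
  induction l with
  | nil => rfl
  | cons p l ih =>
    simp only [List.map_cons, assocGet, Nat.unpair_pair, rhsOf, ih]
    split <;> rfl

/-- The finite table of the partial derivatives of the function symbols. -/
theorem TermLanguage.exists_pdTable (L : TermLanguage) : ∃ l : List ℕ,
    ∀ (h : Fin L.num) (i : Fin (L.arity h)), assocGet 0 l (Nat.pair h i) = (L.pd h i).code := by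
  refine ⟨(List.finRange L.num).flatMap fun h => (List.finRange (L.arity h)).map fun (i : Fin (L.arity h)) =>
    Nat.pair (Nat.pair h i) (L.pd h i).code, fun h i => assocGet_of_mem ?_ ?_⟩
  · simp only [List.mem_flatMap, List.mem_map]
    exact ⟨h, List.mem_finRange h, i, List.mem_finRange i, rfl⟩
  · simp only [List.mem_flatMap, List.mem_map]
    rintro _ ⟨h', -, i', -, rfl⟩ heq
    simp only [Nat.unpair_pair, Nat.pair_eq_pair] at heq ⊢
    obtain rfl : h' = h := Fin.ext heq.1
    rw [Fin.ext heq.2]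

open RecExpr in
theorem TermLanguage.exists_lie (L : TermLanguage) : ∃ F : ℕ →. ℕ, Partrec F ∧
    ∀ (o : ODE L.toSignature) (e : L.ET),
      F (Nat.pair o.code e.code) = Part.some (lie o.rhs e).code := by
  obtain ⟨G, hG, hG'⟩ := exists_lookup
  obtain ⟨N, hN, hN'⟩ := exists_enumPairs
  obtain ⟨B, hB, hB'⟩ := exists_bind (S := L.toSignature)
  obtain ⟨tbl, htbl⟩ := L.exists_pdTable
  let o := RecExpr.fst inp
  let t := RecExpr.snd inp
  let body := RecExpr.snd t
  let zero := RecExpr.lit (ETerm.const 0 : L.ET).code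
  let idx := RecExpr.fst (snd body)
  let env := RecExpr.fst (snd (snd body))
  let rest := RecExpr.snd (snd (snd body))
  obtain ⟨F, hF, h⟩ := exists_partrec
    -- The code of a differential equation is itself an association list, and the default zero
    -- covers variables that do not evolve.
    (ifEq (fst t) (lit 0) (prim G hG (pair zero (pair o body)))
    (ifEq (fst t) (lit 1) zero
    (ifEq (fst t) (lit 2) (tag 2 (self (pair o (fst body))) (self (pair o (snd body))))
    (ifEq (fst t) (lit 3)
      (tag 2 (tag 3 (self (pair o (fst body))) (snd body))
        (tag 3 (fst body) (self (pair o (snd body)))))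
    -- The chain rule runs under tag `5` with state: function symbol, argument position, enumerated
    -- arguments as substitution, remaining arguments. Partial derivatives are read from the finite
    -- table.
    (ifEq (fst t) (lit 4)
      (self (pair o (pair (lit 5) (pair (fst body) (pair (lit 0)
        (pair (prim N hN (pair (lit 0) (snd body))) (snd body)))))))
    (ifEq rest (lit 0) zero
      (tag 2
        (tag 3
          (prim B hB (pair env (prim G hG (pair (lit 0)
            (pair (lit (Encodable.encode tbl)) (pair (fst body) idx))))))
          (self (pair o (hd rest))))
        (self (pair o (pair (lit 5) (pair (fst body) (pair (succ idx)
          (pair env (tl rest))))))))))))))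
  refine ⟨F, hF, fun D e => ?_⟩
  induction e with
  | var n =>
    have := assocGet_sys D.sys n
    rw [h]
    simpa [zero, o, t, body, ETerm.code, ODE.code, hG', ODE.rhs] using this
  | const c => rw [h]; simp [t, zero, ETerm.code]
  | add a b iha ihb => rw [h]; simp [o, t, body, tag, ETerm.code, iha, ihb]
  | mul a b iha ihb => rw [h]; simp [o, t, body, tag, ETerm.code, iha, ihb]
  | app f args ih =>
    let cs := List.ofFn fun i => (args i).code
    have hbind (i : Fin (L.arity f)) :
        B (Nat.pair (Encodable.encode (enumPairs 0 cs)) (L.pd f i).code) = Part.some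
          ((L.pd f i).bind fun n => if hn : n < L.arity f then args ⟨n, hn⟩ else .const 0).code := by
      refine hB' _ _ _ fun n hn => ?_
      have hn := L.pd_vars f i n hn
      have := assocGet_enumPairs (Nat.pair 0 n) cs 0 n (by simpa [cs] using hn)
      rw [zero_add] at this
      rw [this, dif_pos hn]
      simp [cs]
    let ts : List L.ET := List.ofFn fun i =>
      .mul ((L.pd f i).bind fun n => if hn : n < L.arity f then args ⟨n, hn⟩ else .const 0)
        (lie D.rhs (args i))
    -- Induction on the number `m` of arguments still to be processed.
    have hsum (m i : ℕ) (hi : i + m = L.arity f) :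
        F (Nat.pair D.code (Nat.pair 5 (Nat.pair f (Nat.pair i
          (Nat.pair (Encodable.encode (enumPairs 0 cs)) (Encodable.encode (cs.drop i))))))) =
        Part.some (ETerm.sum (ts.drop i)).code := by
      induction m generalizing i with
      | zero =>
        rw [h, List.drop_eq_nil_of_le (by simp [cs]; omega),
          List.drop_eq_nil_of_le (by simp [ts]; omega)]
        simp [t, body, rest, zero, ETerm.sum]
      | succ m ihm =>
        have hia : i < L.arity f := by omega
        rw [h, List.drop_eq_getElem_cons (i := i) (by simpa [cs] using hia),
          List.drop_eq_getElem_cons (i := i) (l := ts) (by simpa [ts] using hia)]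
        have h₁ : cs[i]'(by simpa [cs] using hia) = (args ⟨i, hia⟩).code := by simp [cs]
        have h₂ : ts[i]'(by simpa [ts] using hia) = .mul ((L.pd f ⟨i, hia⟩).bind fun n =>
          if hn : n < L.arity f then args ⟨n, hn⟩ else .const 0)
            (lie D.rhs (args ⟨i, hia⟩)) := by simp [ts]
        have h₃ := htbl f ⟨i, hia⟩
        simp only at h₃
        simp only [h₁, h₂]
        simp [o, t, body, rest, env, idx, tag, hd, tl, hG', h₃, hbind, ih, ihm (i + 1) (by omega),
          ETerm.sum, ETerm.code]
    have := hsum (L.arity f) 0 (by omega)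
    rw [h]
    simp only [List.drop_zero] at this
    simp only [ETerm.code, lie]
    simp [o, t, body]
    rw [hN']
    simpa using this

end

/-! ### The algorithm -/

open RecExpr ETerm in
/-- The algorithm computes a term from the code of a program and a list of terms. For loops and
differential equations the list holds the iterates that are found so far, the latest one first, and
otherwise it holds only the term of the postcondition. -/
theorem TermLanguage.exists_step (L : TermLanguage) (M : ℕ →. ℕ) (hM : Partrec M) :
    ∃ C : ℕ →. ℕ, Partrec C ∧
      (∀ (x : Var) (e t : L.ET),
        C (Nat.pair (Program.assign x e).code (Encodable.encode [t.code])) =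
          Part.some (t.bind (single x e)).code) ∧
      (∀ (A : SFml L.toSignature) (t : L.ET),
        C (Nat.pair (Program.test (.not A)).code (Encodable.encode [t.code])) =
          Part.some (ETerm.mul A.eqTerm t).code) ∧
      (∀ (o : ODE L.toSignature) (A : SFml L.toSignature) (t : L.ET) (n : ℕ)
        (r : Option (List L.ET)), Encodable.encode (r.map (List.map code)) ∈
            M (Nat.pair ((lie o.rhs)^[n + 1] t).code
              (Encodable.encode ((orbit (lie o.rhs) t n).map code))) →
        C (Nat.pair (Program.ode o (.not A)).code
            (Encodable.encode ((orbit (lie o.rhs) t n).map code))) =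
          if r = none then C (Nat.pair (Program.ode o (.not A)).code
            (Encodable.encode ((orbit (lie o.rhs) t (n + 1)).map code)))
          else Part.some (ETerm.mul A.eqTerm (sumSq (orbit (lie o.rhs) t n))).code) ∧
      (∀ (α β : Program L.toSignature) (t a b : L.ET),
        C (Nat.pair α.code (Encodable.encode [t.code])) = Part.some a.code →
        C (Nat.pair β.code (Encodable.encode [t.code])) = Part.some b.code →
        C (Nat.pair (Program.choice α β).code (Encodable.encode [t.code])) =
          Part.some (sumSq [a, b]).code) ∧
      (∀ (α β : Program L.toSignature) (t a b : L.ET),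
        C (Nat.pair β.code (Encodable.encode [t.code])) = Part.some b.code →
        C (Nat.pair α.code (Encodable.encode [b.code])) = Part.some a.code →
        C (Nat.pair (Program.seq α β).code (Encodable.encode [t.code])) = Part.some a.code) ∧
      (∀ (α : Program L.toSignature) (G : L.ET → L.ET) (t : L.ET) (n : ℕ)
        (r : Option (List L.ET)),
        (∀ e : L.ET, C (Nat.pair α.code (Encodable.encode [e.code])) = Part.some (G e).code) →
        Encodable.encode (r.map (List.map code)) ∈ M (Nat.pair (G^[n + 1] t).code
          (Encodable.encode ((orbit G t n).map code))) →
        C (Nat.pair (Program.star α).code (Encodable.encode ((orbit G t n).map code))) =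
          if r = none then C (Nat.pair (Program.star α).code
            (Encodable.encode ((orbit G t (n + 1)).map code)))
          else Part.some (sumSq (orbit G t n)).code) := by
  obtain ⟨B, hB, hB'⟩ := exists_bind (S := L.toSignature)
  obtain ⟨Q, hQ, hQ'⟩ := exists_sumSq (S := L.toSignature)
  obtain ⟨T, hT, hT'⟩ := exists_eqTerm (S := L.toSignature)
  obtain ⟨D, hD, hD'⟩ := L.exists_lie
  let α := RecExpr.fst inp
  let ts := RecExpr.snd inp
  let body := RecExpr.snd α
  -- Inside `letIn` the input is the new iterate paired with the old input, so the projections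
  -- shift.
  let α₁ := RecExpr.fst (RecExpr.snd inp)
  let ts₁ := RecExpr.snd (RecExpr.snd inp)
  obtain ⟨C, hC, h⟩ := exists_partrec
    (ifEq (fst α) (lit 0)
      -- Assigning a differential variable, whose order is nonzero, does not affect an extended
      -- term.
      (ifEq (snd (fst body)) (lit 0)
        (prim B hB (pair (RecExpr.cons (pair (fst (fst body)) (snd body)) (lit 0)) (hd ts)))
        (hd ts))
    (ifEq (fst α) (lit 1) (tag 3 (prim T hT (snd body)) (hd ts))
    (ifEq (fst α) (lit 2)
      (letIn (prim D hD (pair (fst body) (hd ts)))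
        -- The code of `none` is `0`: without cofactors, the new iterate joins the orbit and the
        -- search goes on.
        (ifEq (prim M hM (pair (fst inp) ts₁)) (lit 0)
          (self (pair α₁ (RecExpr.cons (fst inp) ts₁)))
          (tag 3 (prim T hT (snd (snd (snd α₁)))) (prim Q hQ ts₁))))
    (ifEq (fst α) (lit 3)
      (prim Q hQ (RecExpr.cons (self (pair (fst body) ts))
        (RecExpr.cons (self (pair (snd body) ts)) (lit 0))))
    (ifEq (fst α) (lit 4)
      (self (pair (fst body) (RecExpr.cons (self (pair (snd body) ts)) (lit 0))))
      -- The remaining case is the loop: the next iterate is the result for the loop body on the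
      -- latest one.
      (letIn (self (pair body (RecExpr.cons (hd ts) (lit 0))))
        (ifEq (prim M hM (pair (fst inp) ts₁)) (lit 0)
          (self (pair α₁ (RecExpr.cons (fst inp) ts₁)))
          (prim Q hQ ts₁))))))))
  refine ⟨C, hC, ?_, ?_, ?_, ?_, ?_, ?_⟩
  · rintro ⟨m, k⟩ e t
    rw [h]
    cases k with
    | zero =>
      have := hB' [Nat.pair m e.code] (single ⟨m, 0⟩ e) t (fun n _ => by
        by_cases hn : m = n
        · simp [assocGet, single, Var.base, hn]
        · simp [assocGet, single, Var.base, hn, Ne.symm hn, ETerm.code])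
      simp at this
      simp [α, ts, body, hd, RecExpr.cons, Program.code, this]
    | succ k =>
      rw [bind_single_of_not_mem fun h => by simpa using baseVars_ord h]
      simp [α, ts, body, hd, Program.code]
  · intro A t
    rw [h]
    simp [α, ts, body, hd, tag, Program.code, SFml.code, hT', ETerm.code]
  · intro o A t n r hr
    obtain ⟨l, hl⟩ := orbit_eq_cons (lie o.rhs) t n
    rw [h]
    rw [Function.iterate_succ_apply'] at hr
    have hr := Part.eq_some_iff.2 hr
    have hs := hQ' (orbit (lie o.rhs) t n)
    have ho : orbit (lie o.rhs) t (n + 1) = lie o.rhs ((lie o.rhs)^[n] t) ::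
      orbit (lie o.rhs) t n := by rw [orbit, Function.iterate_succ_apply']
    rw [ho]
    rw [hl] at hr hs ⊢
    simp only [List.map_cons, Encodable.encode_list_cons, Encodable.encode_nat] at hr hs ⊢
    cases r <;>
      simp [α, ts, body, α₁, ts₁, hd, tag, RecExpr.cons, Program.code, SFml.code, hT', hD'] <;>
      simp at hr hs <;> simp [hr, hs, ETerm.code]
  · intro α' β' t a b ha hb
    have := hQ' [a, b]
    rw [h]
    simp at ha hb this
    simp [α, ts, body, RecExpr.cons, Program.code, ha, hb, this]
  · intro α' β' t a b hb ha
    rw [h]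
    simp at ha hb
    simp [α, ts, body, RecExpr.cons, Program.code, ha, hb]
  · intro α' G t n r hG hr
    obtain ⟨l, hl⟩ := orbit_eq_cons G t n
    rw [h]
    rw [Function.iterate_succ_apply'] at hr
    have hr := Part.eq_some_iff.2 hr
    have hs := hQ' (orbit G t n)
    have ho : orbit G t (n + 1) = G (G^[n] t) :: orbit G t n := by
      rw [orbit, Function.iterate_succ_apply']
    rw [ho]
    rw [hl] at hr hs ⊢
    simp only [List.map_cons, Encodable.encode_list_cons, Encodable.encode_nat] at hr hs ⊢
    simp at hG
    cases r <;>
      simp [α, ts, body, α₁, ts₁, hd, RecExpr.cons, Program.code, hG] <;>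
      simp at hr hs <;> simp [hr, hs]

/-- Unbounded search along an orbit. -/
theorem exists_of_search {α β : Type*} (f : ℕ → Part α) (g : ℕ → α) (r : ℕ → Option β)
    (h : ∀ n, f n = if r n = none then f (n + 1) else Part.some (g n)) (hr : ∃ n, r n ≠ none) :
    ∃ n, r n ≠ none ∧ f 0 = Part.some (g n) := by
  classical
  refine ⟨Nat.find hr, Nat.find_spec hr, ?_⟩
  have : ∀ m ≤ Nat.find hr, f 0 = f m := by
    intro m hm
    induction m with
    | zero => rfl
    | succ m ih =>
      have hn : r m = none := not_not.1 (Nat.find_min hr (Nat.lt_of_succ_le hm))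
      rw [ih (by omega), h m, if_pos hn]
  rw [this _ le_rfl, h, if_neg (Nat.find_spec hr)]

-- The set `W` is chosen before `t`. This uniformity keeps all iterates along a loop within the
-- finite set `W ∪ t.vars`, as required for the Noetherian property.
open ETerm in
theorem TermLanguage.exists_algorithm (L : TermLanguage) (hN : L.IsNoetherian)
    (hM : L.DecidesIdealMembership) : ∃ C : ℕ →. ℕ, Partrec C ∧
      ∀ α : Program L.toSignature, α.IsAnalytic → ∃ W : Finset ℕ, ∀ t : L.ET, ∃ e : L.ET,
        C (Nat.pair α.code (Encodable.encode [t.code])) = Part.some e.code ∧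
        e.vars ⊆ W ∪ t.vars ∧
        Provable L [] (.iff (.box α (.eq t.toTerm (.const 0))) (.eq e.toTerm (.const 0))) := by
  obtain ⟨M, hMp, hM⟩ := hM
  choose R hR₁ hR₂ using hM
  obtain ⟨C, hC, hassign, htest, hode, hchoice, hseq, hstar⟩ := L.exists_step M hMp
  -- The search terminates: once membership holds, the answer `none` would be wrong.
  have hfind {V : Finset ℕ} {G : L.ET → L.ET} {t : L.ET} (hV : ∀ i, (G^[i] t).vars ⊆ V) :
      ∃ n, R (G^[n + 1] t) (orbit G t n) ≠ none := by
    obtain ⟨n, hn⟩ := hN.exists_inIdeal hV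
    refine ⟨n, fun hnone => ?_⟩
    have := hR₂ (G^[n + 1] t) (orbit G t n)
    rw [hnone] at this
    exact this hn
  have hcomb {G : L.ET → L.ET} {t : L.ET} {n : ℕ} (hn : R (G^[n + 1] t) (orbit G t n) ≠ none) :
      ∃ gs, Provable L [] (.eq (G^[n + 1] t).toTerm (combination gs (orbit G t n)).toTerm) := by
    obtain ⟨gs, hgs⟩ := Option.ne_none_iff_exists'.1 hn
    have := hR₂ (G^[n + 1] t) (orbit G t n)
    rw [hgs] at this
    exact ⟨gs, this.2⟩
  have hvars {V : Finset ℕ} {G : L.ET → L.ET} {t : L.ET} (hV : ∀ i, (G^[i] t).vars ⊆ V) (n : ℕ) :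
      (sumSq (orbit G t n)).vars ⊆ V := by
    refine vars_sumSq_subset fun e he => ?_
    obtain ⟨i, -, rfl⟩ := mem_orbit.1 he
    exact hV i
  refine ⟨C, hC, fun α hα => ?_⟩
  induction α with
  | assign x e =>
    refine ⟨e.vars, fun t => ⟨_, hassign x e t, vars_bind_subset fun n hn => ?_,
      .box_assign_iff x e t⟩⟩
    rw [single]
    split
    · exact Finset.subset_union_left
    · simpa [vars] using .inr hn
  | test Q =>
    obtain ⟨A, hA, rfl⟩ := hα
    exact ⟨A.eqTerm.vars, fun t => ⟨_, htest A t, subset_rfl,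
      .box_test_iff hA.aholds_not_iff t⟩⟩
  | ode o Q =>
    obtain ⟨A, hA, rfl⟩ := hα
    refine ⟨A.eqTerm.vars ∪ o.vars, fun t => ?_⟩
    have hV : ∀ i, ((lie o.rhs)^[i] t).vars ⊆ o.vars ∪ t.vars :=
      vars_iterate_lie_subset Finset.subset_union_right fun n _ =>
        (o.vars_rhs_subset n).trans Finset.subset_union_left
    obtain ⟨n, hn, hCn⟩ := exists_of_search
      (fun n => C (Nat.pair (Program.ode o (.not A)).code
        (Encodable.encode ((orbit (lie o.rhs) t n).map code))))
      (fun n => (ETerm.mul A.eqTerm (sumSq (orbit (lie o.rhs) t n))).code)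
      (fun n => R ((lie o.rhs)^[n + 1] t) (orbit (lie o.rhs) t n))
      (fun n => hode o A t n _ (hR₁ _ _)) (hfind hV)
    obtain ⟨gs, hgs⟩ := hcomb hn
    refine ⟨_, hCn, ?_, .box_ode_iff o hA.aholds_not_iff t n gs hgs⟩
    rw [vars, Finset.union_assoc]
    exact Finset.union_subset_union_right (hvars hV n)
  | choice α β ihα ihβ =>
    obtain ⟨V, hV⟩ := ihα hα.1
    obtain ⟨W, hW⟩ := ihβ hα.2
    refine ⟨V ∪ W, fun t => ?_⟩
    obtain ⟨a, ha, hav, hap⟩ := hV t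
    obtain ⟨b, hb, hbv, hbp⟩ := hW t
    refine ⟨_, hchoice α β t a b ha hb, vars_sumSq_subset fun e he => ?_,
      .box_choice_iff hap hbp⟩
    simp only [List.mem_cons, List.not_mem_nil, or_false] at he
    rcases he with rfl | rfl
    · exact hav.trans (Finset.union_subset_union_left Finset.subset_union_left)
    · exact hbv.trans (Finset.union_subset_union_left Finset.subset_union_right)
  | seq α β ihα ihβ =>
    obtain ⟨V, hV⟩ := ihα hα.1
    obtain ⟨W, hW⟩ := ihβ hα.2
    refine ⟨V ∪ W, fun t => ?_⟩
    obtain ⟨b, hb, hbv, hbp⟩ := hW t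
    obtain ⟨a, ha, hav, hap⟩ := hV b
    refine ⟨_, hseq α β t a b hb ha, ?_, .box_seq_iff hbp hap⟩
    rw [Finset.union_assoc]
    exact hav.trans (Finset.union_subset_union_right hbv)
  | star α ih =>
    obtain ⟨W, hW⟩ := ih hα
    -- The results for the loop body form a function on terms, whose orbit is searched.
    choose G hG₁ hG₂ hG₃ using hW
    refine ⟨W, fun t => ?_⟩
    have hV (i : ℕ) : (G^[i] t).vars ⊆ W ∪ t.vars := by
      induction i with
      | zero => exact Finset.subset_union_right
      | succ i ih =>
        rw [Function.iterate_succ_apply']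
        exact (hG₂ _).trans (Finset.union_subset Finset.subset_union_left ih)
    obtain ⟨n, hn, hCn⟩ := exists_of_search
      (fun n => C (Nat.pair (Program.star α).code (Encodable.encode ((orbit G t n).map code))))
      (fun n => (sumSq (orbit G t n)).code) (fun n => R (G^[n + 1] t) (orbit G t n))
      (fun n => hstar α G t n _ hG₁ (hR₁ _ _)) (hfind hV)
    obtain ⟨gs, hgs⟩ := hcomb hn
    exact ⟨_, hCn, hvars hV n, .box_star_iff hG₃ hgs⟩

end DL

open DL RecExpr in
theorem mainTheorem8 (L : DL.TermLanguage) (hN : L.IsNoetherian)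
    (hM : L.DecidesIdealMembership) :
    ∃ E : ℕ →. ℕ, Partrec E ∧
      ∀ (α : DL.Program L.toSignature) (P : DL.SFml L.toSignature),
        α.IsAnalytic → P.IsAnalytic →
          ∃ e : L.ET, e.code ∈ E (Nat.pair α.code P.code) ∧
            DL.Provable L []
              (DL.Formula.iff (DL.Formula.box α P.toFormula)
                (DL.Formula.eq e.toTerm (DL.Term.const 0))) := by
  obtain ⟨C, hC, h⟩ := L.exists_algorithm hN hM
  obtain ⟨T, hT, hT'⟩ := exists_eqTerm (S := L.toSignature)
  obtain ⟨E, hE, hE'⟩ := exists_partrec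
    (prim C hC (pair (fst inp) (RecExpr.cons (prim T hT (snd inp)) (lit 0))))
  refine ⟨E, hE, fun α P hα hP => ?_⟩
  obtain ⟨W, hW⟩ := h α hα
  obtain ⟨e, he, -, hep⟩ := hW P.eqTerm
  -- The equivalence of `P` with its single equation is real arithmetic, and a closed derivable
  -- equivalence may be used under the box.
  refine ⟨e, ?_, .iff_trans (.box_iff (.of_valid ?_ fun v => ?_)) hep⟩
  · simp at he
    rw [hE']
    simp [RecExpr.cons, hT', he]
  · exact ⟨⟨P.qf_toFormula, trivial⟩, trivial, P.qf_toFormula⟩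
  · simp [hP.aholds_iff, Term.aeval]
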